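/- **Theorem.** Let $n\ge 1$, write $[n]=\{1,\dots,n\}$ and $[\pm n]=\{\pm1,\dots,\pm n\}$, and let $\mathfrak S_n^B$ be the group of signed permutations, i.e. permutations $\sigma$ of $[\pm n]$ with $\sigma(-i)=-\sigma(i)$. Let $s_0$ exchange $1$ and $-1$, and for $1\le i\le n-1$ let $s_i$ exchange $i$ with $i+1$ and $-i$ with $-(i+1)$, all other elements being fixed. The length $\ell(\sigma)$ is the least $k$ such that $\sigma$ is a product of $k$ of the generators $s_0,\dots,s_{n-1}$, and $$\mathrm{inv}(\sigma)=\#\{(i,j)\in[n]^2: i<j,\ \sigma(i)>\sigma(j)\}+\#\{(i,j)\in[n]^2: i\le j,\ \sigma(-i)>\sigma(j)\}.$$ For $0\le k\le n$, a *$(k,n)$-diagram* is a left-justified diagram of boxes in a $k\times(n-k)$ rectangle with row lengths $\lambda_1\ge\dots\ge\lambda_k\ge0$. Number the unit steps of its southeast border $1,\dots,n$ from the northeast to the southwest corner of the rectangle; each row and each column gets the number of its border step as its label. The *shifted* diagram is obtained by adding a staircase of boxes on top, the $j$th column from the left receiving $n-k-j+1$ additional boxes; the topmost box of each column is called a *diagonal*,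 and the added row whose diagonal lies in column $i$ is labeled $-i$. A *permutation tableau of type $B$ of length $n$* is a filling of a shifted $(k,n)$-diagram (for some $k$) with $0$'s and $1$'s such that (1) every column contains a $1$; (2) a box with a $1$ above it in its column and a $1$ to the left of it in its row contains a $1$; (3) if a diagonal contains a $0$, its row contains no $1$. Let $\mathcal{PT}_n^B$ be the set of these tableaux. The *zigzag path* from a row (column) of $\mathcal T$ enters the row at its left end moving east (the column at its top moving south), switches between east and south whenever it meets a $1$, and ends when it reaches the right end of a row or the bottom of a column. Define $\zeta(\mathcal T)\in\mathfrak S_n^B$ as follows, for $i\in[n]$: if $i$ is a row label, $\zeta(\mathcal T)(i)$ is the label of the row or column where the zigzag path from row $i$ ends; if $-i$ is a row label and row $-i$ has $0$ in its diagonal, $\zeta(\mathcal T)(i)$ is the label where the path from column $i$ ends; if $-i$ is a row label and row $-i$ has $1$ in its diagonal, $\zeta(\mathcal T)(-i)$ is the label where the path from row $-i$ ends. Through each $0$ of $\mathcal T$ pass two zigzag paths, one horizontally and one vertically; let $\mathrm{zero}_{EE}(\mathcal T)$ (respectively $\mathrm{zero}_{NN}(\mathcal T)$) be the number of $0$'s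 for which both paths start from rows (respectively both from columns), and let $\mathrm{one}(\mathcal T)$ be the number of $1$'s in $\mathcal T$. Then for every $\sigma\in\mathfrak S_n^B$ there is a unique $\mathcal T=\zeta^{-1}(\sigma)\in\mathcal{PT}_n^B$ with $\zeta(\mathcal T)=\sigma$, and $$\ell(\sigma)=\mathrm{inv}(\sigma)=2\bigl(\mathrm{zero}_{EE}(\mathcal T)+\mathrm{zero}_{NN}(\mathcal T)\bigr)+\mathrm{one}(\mathcal T).$$ -/

import Mathlib

/-! ### Signed permutations -/

/-- The set `[±n] = {±1, …, ±n}`. -/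
abbrev PM (n : ℕ) : Type := {z : ℤ // z ≠ 0 ∧ -(n : ℤ) ≤ z ∧ z ≤ n}

namespace PM

noncomputable instance instFintype (n : ℕ) : Fintype (PM n) :=
  Fintype.subtype ((Finset.Icc (-(n : ℤ)) n).filter (fun z => z ≠ 0)) (by
    intro z
    simp only [Finset.mem_filter, Finset.mem_Icc]
    tauto)

instance instNeg (n : ℕ) : Neg (PM n) :=
  ⟨fun x => ⟨-x.1, by have := x.2; omega⟩⟩

@[simp] theorem val_neg {n : ℕ} (x : PM n) : (-x).1 = -x.1 := rfl

end PM

/-- The group of signed permutations: permutations `σ` of `[±n]` with `σ(-i) = -σ(i)`. -/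
def SignedPerm (n : ℕ) : Subgroup (Equiv.Perm (PM n)) where
  carrier := {σ | ∀ x, σ (-x) = -σ x}
  one_mem' := fun _ => rfl
  mul_mem' := by
    intro a b ha hb x
    simp only [Set.mem_ofPred_eq] at ha hb
    simp [Equiv.Perm.mul_apply, ha, hb]
  inv_mem' := by
    intro a ha x
    simp only [Set.mem_ofPred_eq] at ha
    rw [Equiv.Perm.inv_eq_iff_eq, ha]
    simp

namespace SignedPerm

/-- `s₀` exchanges `1` and `-1`; for `i ≥ 1`, `sᵢ` exchanges `i` with `i + 1` and
`-i` with `-(i + 1)`. -/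
def simpleFun (i : ℤ) (x : ℤ) : ℤ :=
  if i = 0 then (if x = 1 ∨ x = -1 then -x else x)
  else if x = i then i + 1
  else if x = i + 1 then i
  else if x = -i then -(i + 1)
  else if x = -(i + 1) then -i
  else x

/-- `simpleFun` as a self-map of `[±n]`, for `i ∈ {0, …, n - 1}`. -/
def simpleMap {n : ℕ} (i : Fin n) (x : PM n) : PM n :=
  ⟨simpleFun (i.1 : ℤ) x.1, by
    have h1 := x.2
    have h2 := i.2
    unfold simpleFun
    split_ifs <;> omega⟩

theorem simpleMap_involutive {n : ℕ} (i : Fin n) :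
    Function.Involutive (simpleMap i) := by
  intro x
  apply Subtype.ext
  have h1 := x.2
  have h2 := i.2
  simp only [simpleMap, simpleFun]
  split_ifs <;> omega

/-- The generator `sᵢ` of the group of signed permutations, `i ∈ {0, …, n - 1}`. -/
def simple {n : ℕ} (i : Fin n) : SignedPerm n :=
  ⟨(simpleMap_involutive i).toPerm, by
    intro x
    apply Subtype.ext
    have h1 := x.2
    have h2 := i.2
    simp only [Function.Involutive.coe_toPerm, simpleMap, simpleFun, PM.val_neg]
    split_ifs <;> omega⟩

/-- The length `ℓ(σ)`: the least `k` such that `σ` is a product of `k` generators. -/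
noncomputable def length {n : ℕ} (σ : SignedPerm n) : ℕ :=
  sInf {k | ∃ w : List (Fin n), w.length = k ∧ (w.map simple).prod = σ}

/-- The number of inversions `inv(σ)`: the pairs `i < j` in `[n]` with `σ(i) > σ(j)`, together with
the pairs `i ≤ j` in `[n]` with `σ(-i) > σ(j)`. A pair that satisfies both conditions is counted
twice. -/
noncomputable def inv {n : ℕ} (σ : SignedPerm n) : ℕ :=
  (Finset.univ.filter (fun p : PM n × PM n =>
    0 < p.1.1 ∧ p.1 < p.2 ∧ σ.1 p.2 < σ.1 p.1)).card +
  (Finset.univ.filter (fun p : PM n × PM n =>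
    0 < p.1.1 ∧ p.1 ≤ p.2 ∧ σ.1 p.2 < σ.1 (-p.1))).card

end SignedPerm

/-! ### Shifted diagrams and permutation tableaux of type `B`

A `(k, n)`-diagram (`0 ≤ k ≤ n`) is recorded by the set `C ⊆ [n]` of its `n - k` column labels,
i.e. by the set of horizontal steps of its southeast border, whose steps are numbered `1, …, n` from
the northeast corner to the southwest corner. The labels of the rows and columns serve as
coordinates: row labels increase from top to bottom, and column labels decrease from left to
right. -/

/-- `r` is the label of a row of the shifted diagram with column labels `C`: either `r ∈ [n]` labels
a row of the `(k, n)`-subdiagram, or `r = -i` where `i` labels a column (the row of the staircase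
whose diagonal lies in column `i`). -/
def IsRowLabel (n : ℕ) (C : Finset ℤ) (r : ℤ) : Prop :=
  (1 ≤ r ∧ r ≤ n ∧ r ∉ C) ∨ -r ∈ C

/-- Row `r` and column `c` of the shifted diagram meet in a box. For `r > 0` this says that the
border step `r` comes before the border step `c`; for `r = -i` it says that column `c` is column
`i` or lies to the left of it. -/
def IsBox (n : ℕ) (C : Finset ℤ) (r c : ℤ) : Prop :=
  IsRowLabel n C r ∧ c ∈ C ∧ |r| ≤ c

/-- Permutation tableaux of type `B` of length `n`. The `(0,1)`-filling is given by the set `ones` of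
the boxes that are filled with `1`; all other boxes are filled with `0`. -/
@[ext] structure PermTableauB (n : ℕ) where
  /-- The column labels. -/
  cols : Finset ℤ
  cols_subset : cols ⊆ Finset.Icc 1 (n : ℤ)
  /-- The boxes (row label, column label) filled with `1`. -/
  ones : Finset (ℤ × ℤ)
  ones_isBox : ∀ r c, (r, c) ∈ ones → IsBox n cols r c
  /-- Every column has at least one `1`. -/
  exists_one : ∀ c ∈ cols, ∃ r, (r, c) ∈ ones
  /-- A box with a `1` above it in its column and a `1` to the left in its row has a `1`. -/
  hinge : ∀ r c r' c', IsBox n cols r c → r' < r → (r', c) ∈ ones → c < c' → (r, c') ∈ ones →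
    (r, c) ∈ ones
  /-- If a diagonal has a `0`, then there is no `1` in its row. -/
  diag : ∀ i ∈ cols, (-i, i) ∉ ones → ∀ c, (-i, c) ∉ ones

/-! ### Zigzag paths -/

/-- The two directions of travel of a zigzag path. -/
inductive Dir : Type
  | east
  | south

/-- A position on a zigzag path: the path enters the place `(row, col)` in the direction `dir`. -/
@[ext] structure ZState where
  dir : Dir
  row : ℤ
  col : ℤ

namespace PermTableauB

variable {n : ℕ}

/-- One step of a zigzag path: it changes the direction at a `1` and goes straight on otherwise.
Places `(r, c)` that are not boxes carry no `1` and are crossed in a straight line. -/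
def step (T : PermTableauB n) : ZState → ZState
  | ⟨.east, r, c⟩ => if (r, c) ∈ T.ones then ⟨.south, r + 1, c⟩ else ⟨.east, r, c - 1⟩
  | ⟨.south, r, c⟩ => if (r, c) ∈ T.ones then ⟨.east, r, c - 1⟩ else ⟨.south, r + 1, c⟩

/-- The zigzag path from row `r` starts at the left of this row, moving east. -/
def rowStart (n : ℕ) (r : ℤ) : ZState := ⟨.east, r, n⟩

/-- The zigzag path from column `c` starts at the top of this column, moving south. -/
def colStart (n : ℕ) (c : ℤ) : ZState := ⟨.south, -n, c⟩

/-- The label of the row or column at which the path starting in the position `s` ends. All boxes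
`(r, c)` have `r < c`. So a path that leaves the diagram at the right end of row `p`, or at the
bottom of column `p`, then goes straight on, and reaches the line `r = c` at the place `(p, p)`.
Each step decreases `c - r` by one. -/
def endLabel (T : PermTableauB n) (s : ZState) : ℤ :=
  ((T.step)^[(s.col - s.row).toNat] s).row

/-- The position at which the path that determines `ζ(T)(±i)` starts, `i ∈ [n]`: row `i` if it
exists, and otherwise column `i` or row `-i` according as row `-i` has `0` or `1` in its diagonal. -/
def zetaStart (T : PermTableauB n) (i : ℤ) : ZState :=
  if i ∉ T.cols then rowStart n i
  else if (-i, i) ∉ T.ones then colStart n i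
  else rowStart n (-i)

/-- The value `ζ(T)(i)` for `i ∈ [n]`. -/
def zetaPos (T : PermTableauB n) (i : ℤ) : ℤ :=
  if i ∉ T.cols then T.endLabel (rowStart n i)
  else if (-i, i) ∉ T.ones then T.endLabel (colStart n i)
  else -T.endLabel (rowStart n (-i))

/-- The map `ζ(T)` on integers, extended from `[n]` by `ζ(T)(-i) = -ζ(T)(i)`. -/
def zetaFun (T : PermTableauB n) (x : ℤ) : ℤ :=
  if 0 < x then T.zetaPos x else -T.zetaPos (-x)

/-! The following facts show that `zetaFun` is a signed permutation. -/

theorem step_injective (T : PermTableauB n) : Function.Injective T.step := by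
  rintro ⟨d, r, c⟩ ⟨d', r', c'⟩ h
  cases d <;> cases d' <;> simp only [step] at h <;> split_ifs at h <;>
    simp only [ZState.mk.injEq, reduceCtorEq, true_and, false_and] at h <;>
    obtain ⟨h1, h2⟩ := h
  · simp_all
  · simp_all
  · obtain rfl : r = r' := by omega
    obtain rfl : c = c' := by omega
    contradiction
  · obtain rfl : r = r' := by omega
    obtain rfl : c = c' := by omega
    contradiction
  · obtain rfl : r = r' := by omega
    obtain rfl : c = c' := by omega
    contradiction
  · obtain rfl : r = r' := by omega
    obtain rfl : c = c' := by omega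
    contradiction
  · simp_all
  · simp_all

/-- What holds along the paths that are used by `ζ`. -/
def Good (T : PermTableauB n) (s : ZState) : Prop :=
  -(n : ℤ) ≤ s.row ∧ s.col ≤ n ∧
  match s.dir with
  | .east => IsRowLabel n T.cols s.row ∧ (s.row < 0 → -s.row ≤ s.col ∧ (s.row, -s.row) ∈ T.ones)
  | .south => s.col ∈ T.cols ∧ (s.row ≤ -s.col → (-s.col, s.col) ∉ T.ones)

theorem good_step (T : PermTableauB n) (s : ZState) (h : T.Good s) : T.Good (T.step s) := by
  obtain ⟨d, r, c⟩ := s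
  obtain ⟨h1, h2, h3⟩ := h
  cases d <;> simp only [step] at * <;> split_ifs with h4
  · obtain ⟨h5, h6, h7⟩ := T.ones_isBox _ _ h4
    refine ⟨by simp only; omega, h2, h6, fun h8 => ?_⟩
    simp only at h8
    have := neg_abs_le r
    omega
  · refine ⟨h1, by simp only; omega, h3.1, fun h8 => ?_⟩
    obtain ⟨h9, h10⟩ := h3.2 h8
    refine ⟨?_, h10⟩
    simp only
    by_contra h11
    obtain rfl : c = -r := by omega
    exact h4 h10
  · obtain ⟨h5, h6, h7⟩ := T.ones_isBox _ _ h4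
    refine ⟨h1, by simp only; omega, h5, fun h8 => ?_⟩
    simp only at h8 ⊢
    have h9 : (r, -r) ∈ T.ones := by
      by_contra h10
      rcases h5 with h5 | h5
      · omega
      · exact T.diag (-r) h5 (by simpa using h10) c (by simpa using h4)
    refine ⟨?_, h9⟩
    rw [abs_of_neg h8] at h7
    by_contra h10
    obtain rfl : c = -r := by omega
    exact h3.2 (by omega) (by simpa using h9)
  · refine ⟨by simp only; omega, h2, h3.1, fun h8 => h3.2 ?_⟩
    simp only at h8 ⊢
    omega

theorem good_iterate (T : PermTableauB n) (s : ZState) (h : T.Good s) (k : ℕ) :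
    T.Good ((T.step)^[k] s) := by
  induction k with
  | zero => exact h
  | succ k ih => rw [Function.iterate_succ_apply']; exact T.good_step _ ih

theorem step_diff (T : PermTableauB n) (s : ZState) :
    (T.step s).col - (T.step s).row = s.col - s.row - 1 := by
  obtain ⟨d, r, c⟩ := s
  cases d <;> simp only [step] <;> split_ifs <;> simp only <;> omega

theorem iterate_diff (T : PermTableauB n) (s : ZState) (k : ℕ) :
    ((T.step)^[k] s).col - ((T.step)^[k] s).row = s.col - s.row - k := by
  induction k with
  | zero => simp
  | succ k ih => rw [Function.iterate_succ_apply', step_diff, ih]; push_cast; ring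

theorem good_zetaStart (T : PermTableauB n) (i : ℤ) (h1 : 1 ≤ i) (h2 : i ≤ n) :
    T.Good (T.zetaStart i) := by
  unfold zetaStart
  split_ifs with h3 h4
  · refine ⟨by simp only [rowStart]; omega, le_refl _, Or.inr ?_, fun _ => ?_⟩
    · simpa [rowStart] using h3
    · simpa [rowStart] using ⟨h2, h4⟩
  · exact ⟨le_refl _, h2, h3, fun _ => h4⟩
  · refine ⟨by simp only [rowStart]; omega, le_refl _, Or.inl ⟨h1, h2, h3⟩, fun h5 => ?_⟩
    simp only [rowStart] at h5
    omega

theorem zetaStart_diff_nonneg (T : PermTableauB n) (i : ℤ) (h1 : 1 ≤ i) (h2 : i ≤ n) :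
    0 ≤ (T.zetaStart i).col - (T.zetaStart i).row := by
  unfold zetaStart
  split_ifs <;> simp only [rowStart, colStart] <;> omega

theorem abs_zetaPos (T : PermTableauB n) (i : ℤ) :
    |T.zetaPos i| = |T.endLabel (T.zetaStart i)| := by
  unfold zetaPos zetaStart
  split_ifs <;> simp

/-- The last position of a path used by `ζ`. -/
theorem end_spec (T : PermTableauB n) (i : ℤ) (h1 : 1 ≤ i) (h2 : i ≤ n) :
    ∃ p : ℤ, T.endLabel (T.zetaStart i) = p ∧ 1 ≤ p ∧ p ≤ n ∧ ∃ k : ℕ,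
      (p ∈ T.cols → (T.step)^[k] (T.zetaStart i) = ⟨.south, p, p⟩) ∧
      (p ∉ T.cols → (T.step)^[k] (T.zetaStart i) = ⟨.east, p, p⟩) := by
  have hd := T.zetaStart_diff_nonneg i h1 h2
  have hg := T.good_iterate _ (T.good_zetaStart i h1 h2)
    ((T.zetaStart i).col - (T.zetaStart i).row).toNat
  have he := T.iterate_diff (T.zetaStart i) ((T.zetaStart i).col - (T.zetaStart i).row).toNat
  refine ⟨_, rfl, ?_⟩
  unfold endLabel
  generalize hk : ((T.zetaStart i).col - (T.zetaStart i).row).toNat = k at *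
  generalize hs : (T.step)^[k] (T.zetaStart i) = s at *
  obtain ⟨d, r, c⟩ := s
  simp only at he ⊢
  obtain rfl : c = r := by omega
  obtain ⟨g1, g2, g3⟩ := hg
  simp only at g1 g2
  cases d
  · obtain ⟨g3, g4⟩ := g3
    simp only at g3 g4
    have hc : 0 ≤ c := by
      by_contra h
      have := (g4 (by omega)).1
      omega
    have g5 : 1 ≤ c ∧ c ∉ T.cols := by
      rcases g3 with g3 | g3
      · exact ⟨g3.1, g3.2.2⟩
      · have := Finset.mem_Icc.1 (T.cols_subset g3)
        omega
    exact ⟨g5.1, g2, k, fun h => absurd h g5.2, fun _ => hs⟩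
  · have g4 := Finset.mem_Icc.1 (T.cols_subset g3.1)
    exact ⟨g4.1, g2, k, fun _ => hs, fun h => absurd g3.1 h⟩

theorem zetaStart_not_step (T : PermTableauB n) (i : ℤ) (s : ZState) (hs : T.Good s) :
    T.step s ≠ T.zetaStart i := by
  obtain ⟨d, r, c⟩ := s
  obtain ⟨h1, h2, -⟩ := hs
  simp only at h1 h2
  intro h
  unfold zetaStart at h
  cases d <;> simp only [step, rowStart, colStart] at h <;> split_ifs at h <;>
    simp only [ZState.mk.injEq, reduceCtorEq, true_and, false_and] at h <;> omega

theorem zetaStart_inj (T : PermTableauB n) (i j : ℤ) (hi : 1 ≤ i) (hj : 1 ≤ j)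
    (h : T.zetaStart i = T.zetaStart j) : i = j := by
  unfold zetaStart at h
  split_ifs at h <;> simp only [rowStart, colStart, ZState.mk.injEq, reduceCtorEq, true_and,
    false_and, and_true] at h <;> omega

theorem start_eq_of_iterate_eq (T : PermTableauB n) (i j : ℤ) (hi : T.Good (T.zetaStart i))
    (k l : ℕ) (hkl : l ≤ k)
    (h : (T.step)^[k] (T.zetaStart i) = (T.step)^[l] (T.zetaStart j)) :
    T.zetaStart i = T.zetaStart j := by
  obtain ⟨m, rfl⟩ := Nat.exists_eq_add_of_le hkl
  rw [Function.iterate_add_apply] at h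
  have h' := T.step_injective.iterate l h
  cases m with
  | zero => exact h'
  | succ m =>
    rw [Function.iterate_succ_apply'] at h'
    exact absurd h' (T.zetaStart_not_step j _ (T.good_iterate _ hi m))

theorem abs_zetaPos_inj (T : PermTableauB n) (i j : ℤ) (hi : 1 ≤ i) (hi' : i ≤ n) (hj : 1 ≤ j)
    (hj' : j ≤ n) (h : |T.zetaPos i| = |T.zetaPos j|) : i = j := by
  rw [abs_zetaPos, abs_zetaPos] at h
  obtain ⟨p, hp, hp1, -, k, hk1, hk2⟩ := T.end_spec i hi hi'
  obtain ⟨q, hq, hq1, -, l, hl1, hl2⟩ := T.end_spec j hj hj'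
  rw [hp, hq, abs_of_pos (by omega), abs_of_pos (by omega)] at h
  subst h
  have hh : (T.step)^[k] (T.zetaStart i) = (T.step)^[l] (T.zetaStart j) := by
    by_cases hc : p ∈ T.cols
    · rw [hk1 hc, hl1 hc]
    · rw [hk2 hc, hl2 hc]
  apply T.zetaStart_inj i j hi hj
  rcases le_total l k with hkl | hkl
  · exact T.start_eq_of_iterate_eq i j (T.good_zetaStart i hi hi') k l hkl hh
  · exact (T.start_eq_of_iterate_eq j i (T.good_zetaStart j hj hj') l k hkl hh.symm).symm

theorem abs_zetaPos_mem (T : PermTableauB n) (i : ℤ) (hi : 1 ≤ i) (hi' : i ≤ n) :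
    1 ≤ |T.zetaPos i| ∧ |T.zetaPos i| ≤ n := by
  rw [abs_zetaPos]
  obtain ⟨p, hp, hp1, hp2, -⟩ := T.end_spec i hi hi'
  rw [hp, abs_of_pos (by omega)]
  exact ⟨hp1, hp2⟩

/-- `ζ(T)` as a self-map of `[±n]`. -/
def zetaMap (T : PermTableauB n) (x : PM n) : PM n :=
  ⟨T.zetaFun x.1, by
    have hx := x.2
    unfold zetaFun
    split_ifs with h
    · have := T.abs_zetaPos_mem x.1 (by omega) (by omega)
      rcases abs_cases (T.zetaPos x.1) with h | h <;> omega
    · have := T.abs_zetaPos_mem (-x.1) (by omega) (by omega)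
      rcases abs_cases (T.zetaPos (-x.1)) with h | h <;> omega⟩

theorem zetaMap_neg (T : PermTableauB n) (x : PM n) : T.zetaMap (-x) = -T.zetaMap x := by
  apply Subtype.ext
  have hx := x.2
  simp only [zetaMap, PM.val_neg, zetaFun]
  split_ifs
  · omega
  · simp
  · simp
  · omega

theorem zetaMap_injective (T : PermTableauB n) : Function.Injective T.zetaMap := by
  intro x y h
  have hx := x.2
  have hy := y.2
  have h' : T.zetaFun x.1 = T.zetaFun y.1 := congrArg Subtype.val h
  apply Subtype.ext
  have key : ∀ i j : ℤ, 1 ≤ i → i ≤ n → 1 ≤ j → j ≤ n → T.zetaPos i ≠ -T.zetaPos j := by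
    intro i j hi hi' hj hj' hij
    have hij' : i = j := T.abs_zetaPos_inj i j hi hi' hj hj' (by rw [hij, abs_neg])
    subst hij'
    have := (T.abs_zetaPos_mem i hi hi').1
    have h0 : T.zetaPos i = 0 := by omega
    rw [h0] at this
    simp at this
  unfold zetaFun at h'
  split_ifs at h'
  · exact T.abs_zetaPos_inj _ _ (by omega) (by omega) (by omega) (by omega) (by rw [h'])
  · exact absurd h' (key _ _ (by omega) (by omega) (by omega) (by omega))
  · exact absurd h'.symm (key _ _ (by omega) (by omega) (by omega) (by omega))
  · have := T.abs_zetaPos_inj (-x.1) (-y.1) (by omega) (by omega) (by omega) (by omega)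
      (by rw [neg_injective h'])
    omega

/-- The zigzag map `ζ` from permutation tableaux of type `B` to signed permutations. -/
noncomputable def zeta (T : PermTableauB n) : SignedPerm n :=
  ⟨Equiv.ofBijective T.zetaMap (Finite.injective_iff_bijective.1 T.zetaMap_injective),
    fun x => T.zetaMap_neg x⟩

/-! ### Statistics on tableaux -/

/-- The zigzag path starting in the position `s` enters the place `(r, c)` in the direction `d`. -/
def Passes (T : PermTableauB n) (s : ZState) (d : Dir) (r c : ℤ) : Prop :=
  ∃ k : ℕ, (T.step)^[k] s = ⟨d, r, c⟩

/-- The zigzag path that passes `(r, c)` in the direction `d` comes from a row of `T`. -/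
def FromRow (T : PermTableauB n) (d : Dir) (r c : ℤ) : Prop :=
  ∃ j, IsRowLabel n T.cols j ∧ T.Passes (rowStart n j) d r c

/-- The zigzag path that passes `(r, c)` in the direction `d` comes from a column of `T`. -/
def FromCol (T : PermTableauB n) (d : Dir) (r c : ℤ) : Prop :=
  ∃ j, j ∈ T.cols ∧ T.Passes (colStart n j) d r c

/-- The box `(r, c)` is filled with `0`. -/
def IsZero (T : PermTableauB n) (r c : ℤ) : Prop :=
  IsBox n T.cols r c ∧ (r, c) ∉ T.ones

/-- The number of `0`s such that the two zigzag paths through it both come from rows. -/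
noncomputable def zeroEE (T : PermTableauB n) : ℕ :=
  {b : ℤ × ℤ | T.IsZero b.1 b.2 ∧ T.FromRow .east b.1 b.2 ∧ T.FromRow .south b.1 b.2}.ncard

/-- The number of `0`s such that the two zigzag paths through it both come from columns. -/
noncomputable def zeroNN (T : PermTableauB n) : ℕ :=
  {b : ℤ × ℤ | T.IsZero b.1 b.2 ∧ T.FromCol .east b.1 b.2 ∧ T.FromCol .south b.1 b.2}.ncard

/-- The number of `1`s. -/
def one (T : PermTableauB n) : ℕ := T.ones.card

end PermTableauB

/-! Zigzag paths behave like pipes: two paths that enter the same place bounce off each other at a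
`1` and cross at a `0`. Each step lowers `col - row` by one, so paths can be compared by `rank` on
every line `col - row = const`, and on the line `row = col` the order by rank is the order of the
end labels. The basic fact: of the two paths leaving a place, the one leaving east ends at the
smaller label. If they meet again, the northeastern one has turned south at a `1` above and the
other has turned east at a `1` to the left, so the hinge condition puts a `1` there and they bounce
(`separated_step`). Hence a place carries a `1` exactly when the path entering from the north has
the smaller end (`mem_ones_iff`), and two paths cross in a `0` exactly once or never, according as
the order of their ends reverses that of their starts or not (`exists_cross`, `Cross.unique`).

Statistics: all paths are prolonged back to the line `col - row = 2 * n`, where the columns start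
northeast of the rows. Zeros are then crossings inside the diagram. With `SE` the number of
crossings of a column path with a row path, the number of boxes is `one + zeroEE + zeroNN + SE`, so
the formula for `inv` says that `inv = boxes + zeroEE + zeroNN - SE`. Every term on the right counts
pairs of labels by conditions on the columns and on the ends of the paths, and the ends are read off
from `ζ(T)`; so the identity is checked for each pair of indices in `[n]` separately
(`pair_contribution`).

Bijectivity: `ζ(T)` determines the columns, as the `i` with `ζ(T)(i) < i`, and all the ends; by
`mem_ones_iff` the filling is then forced along successive lines `col - row = const`. Conversely,
given the ends, the same rule builds a tableau column by column from the left: at each place the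
smaller end leaves east and the larger one south, with a `1` where the entering paths need not
cross. The invariant `PathEnds.Good`, whose core is the pigeonhole argument `Good.le_carry`, shows
that the result is a tableau with the prescribed ends.

Length: right multiplication by `sᵢ` permutes the positive roots other than the `i`th simple one, so
it changes `inv` by exactly one, and only the identity inverts no simple root. -/

/-! ### Zigzag paths as pipes -/

namespace PermTableauB

variable {n : ℕ}

/-- The rank of a position among the positions with the same value of `col - row`, counted from the
northeast. -/
def _root_.ZState.rank (s : ZState) : ℤ :=
  match s.dir with
  | .east => 2 * s.col + 1
  | .south => 2 * s.col

/-- A path travels east only along rows of the diagram, and south only along columns. -/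
def Valid (T : PermTableauB n) (s : ZState) : Prop :=
  match s.dir with
  | .east => IsRowLabel n T.cols s.row
  | .south => s.col ∈ T.cols

theorem mem_cols_bounds (T : PermTableauB n) {c : ℤ} (h : c ∈ T.cols) : 1 ≤ c ∧ c ≤ n :=
  Finset.mem_Icc.1 (T.cols_subset h)

theorem ones_bounds (T : PermTableauB n) {r c : ℤ} (h : (r, c) ∈ T.ones) :
    IsRowLabel n T.cols r ∧ c ∈ T.cols ∧ 1 ≤ c ∧ c ≤ n ∧ -c ≤ r ∧ r < c := by
  obtain ⟨h1, h2, h3⟩ := T.ones_isBox r c h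
  obtain ⟨h4, h5⟩ := T.mem_cols_bounds h2
  obtain ⟨h6, h7⟩ := abs_le.1 h3
  refine ⟨h1, h2, h4, h5, h6, lt_of_le_of_ne h7 ?_⟩
  rintro rfl
  rcases h1 with h1 | h1
  · exact h1.2.2 h2
  · have := T.mem_cols_bounds h1
    omega

theorem isRowLabel_bounds (T : PermTableauB n) {r : ℤ} (h : IsRowLabel n T.cols r) :
    -(n : ℤ) ≤ r ∧ r ≤ n ∧ r ≠ 0 ∧ r ∉ T.cols := by
  rcases h with h | h
  · exact ⟨by omega, h.2.1, by omega, h.2.2⟩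
  · have := T.mem_cols_bounds h
    refine ⟨by omega, by omega, by omega, fun h' => ?_⟩
    have := T.mem_cols_bounds h'
    omega

/-- The `1` above already forces `-c ≤ r' < r`, so together with `r < c` the place is a box and the
hinge condition applies. -/
theorem hinge_of_lt (T : PermTableauB n) {r c r' c' : ℤ} (h1 : (r', c) ∈ T.ones) (h2 : r' < r)
    (h3 : (r, c') ∈ T.ones) (h4 : c < c') (h5 : r < c) : (r, c) ∈ T.ones := by
  have h6 := T.ones_bounds h1
  have h7 := T.ones_bounds h3
  exact T.hinge r c r' c' ⟨h7.1, h6.2.1, abs_le.2 ⟨by omega, by omega⟩⟩ h2 h1 h4 h3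

theorem valid_step (T : PermTableauB n) {s : ZState} (h : T.Valid s) : T.Valid (T.step s) := by
  obtain ⟨d, r, c⟩ := s
  cases d <;> simp only [step] <;> split_ifs with h1
  · exact (T.ones_bounds h1).2.1
  · exact h
  · exact (T.ones_bounds h1).1
  · exact h

theorem valid_iterate (T : PermTableauB n) {s : ZState} (h : T.Valid s) (k : ℕ) :
    T.Valid ((T.step)^[k] s) := by
  induction k with
  | zero => exact h
  | succ k ih => rw [Function.iterate_succ_apply']; exact T.valid_step ih

theorem endLabel_of_diff_eq_zero (T : PermTableauB n) {s : ZState} (h : s.col = s.row) :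
    T.endLabel s = s.row := by
  simp [endLabel, h]

theorem endLabel_step (T : PermTableauB n) {s : ZState} (h : s.row < s.col) :
    T.endLabel (T.step s) = T.endLabel s := by
  unfold endLabel
  rw [step_diff, ← Function.iterate_succ_apply]
  congr 2
  omega

theorem endLabel_iterate (T : PermTableauB n) {s : ZState} (k : ℕ)
    (h : (k : ℤ) ≤ s.col - s.row) : T.endLabel ((T.step)^[k] s) = T.endLabel s := by
  induction k with
  | zero => rfl
  | succ k ih =>
    have h1 := T.iterate_diff s k
    rw [Function.iterate_succ_apply', endLabel_step, ih]
    · push_cast at h; omega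
    · push_cast at h; omega

/-- Induction along a path until it reaches the line `row = col`. -/
theorem path_induction (T : PermTableauB n) {P : ZState → ZState → Prop}
    {Q : ZState → ZState → Prop}
    (hstep : ∀ x y, x.row < x.col → Q x y → Q (T.step x) (T.step y))
    (hend : ∀ x y, x.col = x.row → Q x y → P x y)
    (hback : ∀ x y, x.row < x.col → Q x y → P (T.step x) (T.step y) → P x y)
    (x y : ZState) (hx : x.row ≤ x.col) (h : Q x y) : P x y := by
  obtain ⟨k, hk⟩ : ∃ k : ℕ, x.col - x.row = k := ⟨(x.col - x.row).toNat, by omega⟩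
  induction k generalizing x y with
  | zero => exact hend x y (by push_cast at hk; omega) h
  | succ k ih =>
    have h1 := T.step_diff x
    have h2 : x.row < x.col := by push_cast at hk; omega
    exact hback x y h2 h (ih _ _ (by push_cast at hk; omega) (hstep x y h2 h)
      (by push_cast at hk; omega))

/-- The path `x` runs northeast of the path `y`, and they can only meet in a `1`. -/
def Separated (T : PermTableauB n) (x y : ZState) : Prop :=
  x.col - x.row = y.col - y.row ∧ x.rank < y.rank ∧
  (x.dir = .south → ∃ r < x.row, (r, x.col) ∈ T.ones) ∧
  (y.dir = .east → ∃ c > y.col, (y.row, c) ∈ T.ones)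

/-- A step from column `c` leads to rank `2 * c - 1` or `2 * c`, so paths in different columns keep
their order; in the same place they keep it by bouncing. -/
theorem rank_step_lt (T : PermTableauB n) {x y : ZState} (hd : x.col - x.row = y.col - y.row)
    (h : x.rank < y.rank) (h1 : x.col = y.col → (x.row, x.col) ∈ T.ones) :
    (T.step x).rank < (T.step y).rank := by
  obtain ⟨d, r, c⟩ := x
  obtain ⟨d', r', c'⟩ := y
  simp only at hd h1
  by_cases hc : c = c'
  · subst hc
    obtain rfl : r = r' := by omega
    have h1 := h1 rfl
    cases d <;> cases d' <;> simp only [ZState.rank, step, if_pos h1] at h ⊢ <;> omega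
  · cases d <;> cases d' <;> simp only [ZState.rank, step] at h ⊢ <;> split_ifs <;>
      simp only <;> omega

/-- The last two conditions of `Separated` record the `1`s at which the paths turned towards each
other. When the paths meet, the order of ranks makes `x` go south and `y` east, so these are the two
`1`s that the hinge condition asks for. -/
theorem separated_step (T : PermTableauB n) {x y : ZState} (hx : x.row < x.col)
    (h : T.Separated x y) : T.Separated (T.step x) (T.step y) := by
  obtain ⟨hd, h1, h2, h3⟩ := h
  refine ⟨by rw [step_diff, step_diff, hd], T.rank_step_lt hd h1 ?_, ?_, ?_⟩
  · intro hc
    obtain ⟨d, r, c⟩ := x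
    obtain ⟨d', r', c'⟩ := y
    simp only at hd hc hx
    subst hc
    obtain rfl : r = r' := by omega
    cases d <;> cases d' <;> simp only [ZState.rank] at h1
    · omega
    · omega
    · obtain ⟨r₁, h4, h5⟩ := h2 rfl
      obtain ⟨c₁, h6, h7⟩ := h3 rfl
      exact T.hinge_of_lt h5 h4 h7 h6 hx
    · omega
  · obtain ⟨d, r, c⟩ := x
    cases d <;> simp only [step] <;> split_ifs with h4
    · exact fun _ => ⟨r, by simp, h4⟩
    · simp
    · simp
    · intro _
      obtain ⟨r₁, h5, h6⟩ := h2 rfl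
      exact ⟨r₁, by simp only at h5 ⊢; omega, h6⟩
  · obtain ⟨d, r, c⟩ := y
    cases d <;> simp only [step] <;> split_ifs with h4
    · simp
    · intro _
      obtain ⟨c₁, h5, h6⟩ := h3 rfl
      exact ⟨c₁, by simp only at h5 ⊢; omega, h6⟩
    · exact fun _ => ⟨c, by simp, h4⟩
    · simp

/-- Ranks `2 * p` and `2 * p + 1` would give the same label `p`, but no label belongs to both a row
and a column. -/
theorem lt_of_rank_lt (T : PermTableauB n) {x y : ZState} (hx : T.Valid x) (hy : T.Valid y)
    (h : x.rank < y.rank) (hx' : x.col = x.row) (hy' : y.col = y.row) : x.row < y.row := by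
  obtain ⟨d, r, c⟩ := x
  obtain ⟨d', r', c'⟩ := y
  simp only at hx' hy'
  subst hx' hy'
  cases d <;> cases d' <;> simp only [ZState.rank, Valid] at h hx hy ⊢
  · omega
  · omega
  · refine lt_of_le_of_ne (by omega) ?_
    rintro rfl
    exact (T.isRowLabel_bounds hy).2.2.2 hx
  · omega

theorem endLabel_lt_of_separated (T : PermTableauB n) {x y : ZState} (hx : T.Valid x)
    (hy : T.Valid y) (hd : x.row ≤ x.col) (h : T.Separated x y) :
    T.endLabel x < T.endLabel y := by
  refine T.path_induction (P := fun x y => T.endLabel x < T.endLabel y)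
    (Q := fun x y => T.Valid x ∧ T.Valid y ∧ T.Separated x y) ?_ ?_ ?_ x y hd ⟨hx, hy, h⟩
  · exact fun x y h h' => ⟨T.valid_step h'.1, T.valid_step h'.2.1, T.separated_step h h'.2.2⟩
  · rintro x y h ⟨h1, h2, h3⟩
    have := h3.1
    have h4 : y.col = y.row := by omega
    rw [T.endLabel_of_diff_eq_zero h, T.endLabel_of_diff_eq_zero h4]
    exact T.lt_of_rank_lt h1 h2 h3.2.1 h h4
  · rintro x y h ⟨h1, h2, h3⟩ h4
    have := h3.1
    rwa [T.endLabel_step h, T.endLabel_step (by omega)] at h4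

/-- The two paths that touch in a `1` do not change their order afterwards. -/
theorem endLabel_lt_of_one (T : PermTableauB n) {r c : ℤ} (h : (r, c) ∈ T.ones) :
    T.endLabel ⟨.south, r, c⟩ < T.endLabel ⟨.east, r, c⟩ := by
  obtain ⟨h1, h2, h3, h4, h5, h6⟩ := T.ones_bounds h
  rw [← T.endLabel_step (s := ⟨.south, r, c⟩) h6, ← T.endLabel_step (s := ⟨.east, r, c⟩) h6]
  have hs : T.step ⟨.south, r, c⟩ = ⟨.east, r, c - 1⟩ := by simp [step, h]
  have he : T.step ⟨.east, r, c⟩ = ⟨.south, r + 1, c⟩ := by simp [step, h]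
  rw [hs, he]
  -- The northeastern path now moves east and the other one south, so both turning conditions of
  -- `Separated` are vacuous.
  exact T.endLabel_lt_of_separated h1 h2 (by simp only; omega)
    ⟨by simp only; omega, by simp only [ZState.rank]; omega, by simp, by simp⟩

/-- The two paths that cross in a `0` do not change their order afterwards. -/
theorem endLabel_lt_of_zero (T : PermTableauB n) {r c : ℤ} (hr : IsRowLabel n T.cols r)
    (hc : c ∈ T.cols) (hrc : r < c) (h : (r, c) ∉ T.ones) :
    T.endLabel ⟨.east, r, c⟩ < T.endLabel ⟨.south, r, c⟩ := by
  rw [← T.endLabel_step (s := ⟨.south, r, c⟩) hrc, ← T.endLabel_step (s := ⟨.east, r, c⟩) hrc]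
  have hs : T.step ⟨.south, r, c⟩ = ⟨.south, r + 1, c⟩ := by simp [step, h]
  have he : T.step ⟨.east, r, c⟩ = ⟨.east, r, c - 1⟩ := by simp [step, h]
  rw [hs, he]
  exact T.endLabel_lt_of_separated hr hc (by simp only; omega)
    ⟨by simp only; omega, by simp only [ZState.rank]; omega, by simp, by simp⟩

/-- The filling is recovered from the ends of the paths. Places with `r < -c`, outside the diagram,
are included: they count as crossings. -/
theorem mem_ones_iff (T : PermTableauB n) {r c : ℤ} (hr : IsRowLabel n T.cols r)
    (hc : c ∈ T.cols) (hrc : r < c) :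
    (r, c) ∈ T.ones ↔ T.endLabel ⟨.south, r, c⟩ < T.endLabel ⟨.east, r, c⟩ := by
  refine ⟨T.endLabel_lt_of_one, fun h => ?_⟩
  by_contra h1
  exact lt_asymm h (T.endLabel_lt_of_zero hr hc hrc h1)

/-- Two positions in the same place, the first of smaller rank. -/
theorem eq_south_east {x y : ZState} (hd : x.col - x.row = y.col - y.row)
    (h : x.rank < y.rank) (hc : x.col = y.col) :
    ∃ r c, x = ⟨.south, r, c⟩ ∧ y = ⟨.east, r, c⟩ := by
  obtain ⟨d, r, c⟩ := x
  obtain ⟨d', r', c'⟩ := y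
  simp only at hd hc
  subst hc
  obtain rfl : r = r' := by omega
  cases d <;> cases d' <;> simp only [ZState.rank] at h
  · omega
  · omega
  · exact ⟨r, c, rfl, rfl⟩
  · omega

/-- Paths whose order agrees with the order of their ends keep it. -/
theorem rank_lt_iterate (T : PermTableauB n) {x y : ZState} (hx : T.Valid x) (hy : T.Valid y)
    (hd : x.col - x.row = y.col - y.row) (h : x.rank < y.rank)
    (he : T.endLabel x < T.endLabel y) (k : ℕ) (hk : (k : ℤ) ≤ x.col - x.row) :
    ((T.step)^[k] x).rank < ((T.step)^[k] y).rank := by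
  induction k with
  | zero => exact h
  | succ k ih =>
    push_cast at hk
    have ih := ih (by omega)
    have h1 := T.iterate_diff x k
    have h2 := T.iterate_diff y k
    have h3 := T.endLabel_iterate (s := x) k (by omega)
    have h4 := T.endLabel_iterate (s := y) k (by omega)
    have h5 := T.valid_iterate hx k
    have h6 := T.valid_iterate hy k
    rw [Function.iterate_succ_apply', Function.iterate_succ_apply']
    generalize (T.step)^[k] x = x' at *
    generalize (T.step)^[k] y = y' at *
    have h7 : x'.col - x'.row = y'.col - y'.row := by omega
    refine T.rank_step_lt h7 ih fun hc => ?_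
    obtain ⟨r, c, rfl, rfl⟩ := eq_south_east h7 ih hc
    exact (T.mem_ones_iff h6 h5 (by simp only at *; omega)).2 (by rw [h3, h4]; exact he)

/-- The paths from `x` and `y` cross in a `0` at the place `(r, c)`. -/
def Cross (T : PermTableauB n) (x y : ZState) (r c : ℤ) : Prop :=
  r < c ∧ (r, c) ∉ T.ones ∧
    ∃ k : ℕ, (T.step)^[k] x = ⟨.south, r, c⟩ ∧ (T.step)^[k] y = ⟨.east, r, c⟩

/-! ### Existence, order and uniqueness of crossings. -/

theorem exists_cross (T : PermTableauB n) {x y : ZState} (hx : T.Valid x) (hy : T.Valid y)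
    (hd : x.col - x.row = y.col - y.row) (h0 : x.row ≤ x.col) (h : x.rank < y.rank)
    (he : T.endLabel y < T.endLabel x) : ∃ r c, T.Cross x y r c := by
  have key := T.path_induction
    (P := fun x y => x.rank < y.rank → T.endLabel y < T.endLabel x → ∃ r c, T.Cross x y r c)
    (Q := fun x y => T.Valid x ∧ T.Valid y ∧ x.col - x.row = y.col - y.row)
    ?_ ?_ ?_ x y h0 ⟨hx, hy, hd⟩
  · exact key h he
  · exact fun x y _ h' => ⟨T.valid_step h'.1, T.valid_step h'.2.1, by
      rw [step_diff, step_diff, h'.2.2]⟩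
  · rintro x y h ⟨h1, h2, h3⟩ h4 h5
    have h6 : y.col = y.row := by omega
    rw [T.endLabel_of_diff_eq_zero h, T.endLabel_of_diff_eq_zero h6] at h5
    exact absurd h5 (T.lt_of_rank_lt h1 h2 h4 h h6).not_gt
  · rintro x y h ⟨h1, h2, h3⟩ h4 h5 h6
    by_cases hc : x.col = y.col
    · obtain ⟨r, c, rfl, rfl⟩ := eq_south_east h3 h5 hc
      -- At the first common place a `1` would give the ends the order of the ranks, contrary to
      -- `h6`.
      refine ⟨r, c, h, fun h7 => ?_, 0, rfl, rfl⟩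
      exact lt_asymm h6 (T.endLabel_lt_of_one h7)
    · obtain ⟨r, c, h7, h8, k, h9, h10⟩ := h4 (T.rank_step_lt h3 h5 fun h => absurd h hc)
        (by rwa [T.endLabel_step h, T.endLabel_step (by omega)])
      exact ⟨r, c, h7, h8, k + 1, h9, h10⟩

theorem Cross.endLabel_lt {T : PermTableauB n} {x y : ZState} {r c : ℤ} (hx : T.Valid x)
    (hy : T.Valid y) (hd : x.col - x.row = y.col - y.row) (h : T.Cross x y r c) :
    T.endLabel y < T.endLabel x := by
  obtain ⟨h1, h2, k, h3, h4⟩ := h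
  have h5 := T.iterate_diff x k
  have h6 := T.valid_iterate hx k
  have h7 := T.valid_iterate hy k
  rw [← T.endLabel_iterate (s := x) k (by rw [h3] at h5; simp only at h5; omega),
    ← T.endLabel_iterate (s := y) k (by rw [h3] at h5; simp only at h5; omega), h3, h4]
  rw [h3] at h6
  rw [h4] at h7
  exact T.endLabel_lt_of_zero h7 h6 h1 h2

/-- If `y` started northeast of `x`, the order of the starts would agree with that of the ends. It
would persist, whereas at the crossing `x` is the northeastern path. -/
theorem Cross.rank_lt {T : PermTableauB n} {x y : ZState} {r c : ℤ} (hx : T.Valid x)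
    (hy : T.Valid y) (hd : x.col - x.row = y.col - y.row) (hxy : x ≠ y)
    (h : T.Cross x y r c) : x.rank < y.rank := by
  by_contra h0
  have h1 : y.rank < x.rank := by
    refine lt_of_le_of_ne (not_lt.1 h0) fun h2 => hxy ?_
    obtain ⟨d, r, c⟩ := x
    obtain ⟨d', r', c'⟩ := y
    cases d <;> cases d' <;> simp only [ZState.rank] at h2 hd ⊢ <;>
      simp only [ZState.mk.injEq, true_and, reduceCtorEq, false_and] <;> omega
  have he := h.endLabel_lt hx hy hd
  obtain ⟨h2, h3, k, h4, h5⟩ := h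
  have h6 := T.iterate_diff y k
  rw [h5] at h6
  simp only at h6
  have := T.rank_lt_iterate hy hx hd.symm h1 he k (by omega)
  rw [h4, h5] at this
  simp only [ZState.rank] at this
  omega

theorem Cross.unique {T : PermTableauB n} {x y : ZState} {r c r' c' : ℤ} (hx : T.Valid x)
    (hy : T.Valid y) (hd : x.col - x.row = y.col - y.row)
    (h : T.Cross x y r c) (h' : T.Cross x y r' c') : r = r' ∧ c = c' := by
  -- The chosen witnesses are the times of the two crossings.
  wlog hle : h.2.2.choose ≤ h'.2.2.choose generalizing r c r' c'
  · have := this h' h (le_of_not_ge hle)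
    exact ⟨this.1.symm, this.2.symm⟩
  have he := h.endLabel_lt hx hy hd
  obtain ⟨h4, h5⟩ := h.2.2.choose_spec
  obtain ⟨h4', h5'⟩ := h'.2.2.choose_spec
  generalize h.2.2.choose = k at *
  generalize h'.2.2.choose = k' at *
  rcases hle.eq_or_lt with rfl | hlt
  · rw [h4] at h4'
    simpa using h4'
  exfalso
  obtain ⟨m, rfl⟩ := Nat.exists_eq_add_of_lt hlt
  have hrc := h.1
  have hrc' := h'.1
  have hz := h.2.1
  have h6 := T.iterate_diff x (k + 1)
  have h7 := T.iterate_diff y (k + 1)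
  have h8 := T.iterate_diff x k
  have h9 := T.iterate_diff x (k + m + 1)
  have h10 := T.valid_iterate hx (k + 1)
  have h11 := T.valid_iterate hy (k + 1)
  have h12 := T.endLabel_iterate (s := x) (k + 1) (by
    rw [h4] at h8; simp only at h8; push_cast; omega)
  have h13 := T.endLabel_iterate (s := y) (k + 1) (by
    rw [h4] at h8; simp only at h8; push_cast; omega)
  -- One step after the earlier crossing `y` is northeast of `x` and ends first, so this order
  -- persists; a later crossing would have `x` northeast again.
  have hx1 : (T.step)^[k + 1] x = ⟨.south, r + 1, c⟩ := by
    rw [Function.iterate_succ_apply', h4]; simp [step, hz]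
  have hy1 : (T.step)^[k + 1] y = ⟨.east, r, c - 1⟩ := by
    rw [Function.iterate_succ_apply', h5]; simp [step, hz]
  rw [show k + m + 1 = m + (k + 1) by ring, Function.iterate_add_apply] at h4' h5' h9
  rw [hx1] at h4' h6 h9 h10 h12
  rw [hy1] at h5' h7 h11 h13
  rw [h4'] at h9
  simp only at h6 h7 h9
  have := T.rank_lt_iterate h11 h10 (by simp only; omega) (by simp only [ZState.rank]; omega)
    (by rw [h12, h13]; exact he) m (by simp only; push_cast at h9 h6; omega)
  rw [h4', h5'] at this
  simp only [ZState.rank] at this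
  omega

end PermTableauB

/-! ### Counting the crossings -/

namespace PermTableauB

variable {n : ℕ}

/-- The path from a row (`d = east`) or column (`d = south`) with label `j`, prolonged backwards to
the line `col - row = 2 * n`. -/
def start (n : ℕ) (d : Dir) (j : ℤ) : ZState :=
  match d with
  | .east => ⟨.east, j, j + 2 * n⟩
  | .south => ⟨.south, j - 2 * n, j⟩

/-- `j` is the label of a row (`d = east`) or column (`d = south`). -/
def IsLabel (T : PermTableauB n) (d : Dir) (j : ℤ) : Prop :=
  match d with
  | .east => IsRowLabel n T.cols j
  | .south => j ∈ T.cols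

theorem valid_start (T : PermTableauB n) {d : Dir} {j : ℤ} (h : T.IsLabel d j) :
    T.Valid (start n d j) := by
  cases d <;> exact h

theorem start_diff (d : Dir) (j : ℤ) :
    (start n d j).col - (start n d j).row = 2 * n := by
  cases d <;> simp [start]

theorem start_injective {d d' : Dir} {j j' : ℤ} (h : start n d j = start n d' j') :
    d = d' ∧ j = j' := by
  cases d <;> cases d' <;> simp [start] at h ⊢ <;> exact h

theorem iterate_east (T : PermTableauB n) (r c : ℤ) (k : ℕ)
    (h : ∀ m : ℕ, m < k → (r, c - m) ∉ T.ones) :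
    (T.step)^[k] ⟨.east, r, c⟩ = ⟨.east, r, c - k⟩ := by
  induction k with
  | zero => simp
  | succ k ih =>
    rw [Function.iterate_succ_apply', ih fun m hm => h m (by omega)]
    simp only [step, if_neg (h k (by omega)), ZState.mk.injEq, true_and]
    push_cast
    ring

theorem iterate_south (T : PermTableauB n) (r c : ℤ) (k : ℕ)
    (h : ∀ m : ℕ, m < k → (r + m, c) ∉ T.ones) :
    (T.step)^[k] ⟨.south, r, c⟩ = ⟨.south, r + k, c⟩ := by
  induction k with
  | zero => simp
  | succ k ih =>
    rw [Function.iterate_succ_apply', ih fun m hm => h m (by omega)]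
    simp only [step, if_neg (h k (by omega)), ZState.mk.injEq, true_and, and_true]
    push_cast
    ring

theorem iterate_start_east (T : PermTableauB n) (j : ℤ) (k : ℕ) (hk : (k : ℤ) ≤ n + j) :
    (T.step)^[k] (start n .east j) = ⟨.east, j, j + 2 * n - k⟩ :=
  T.iterate_east _ _ _ fun m hm h => by
    have := T.ones_bounds h
    omega

/-- The bound on `k` lets the path run down to the diagonal row `-j`, beyond the top row `-n`:
column `j` has no `1` above its diagonal. -/
theorem iterate_start_south (T : PermTableauB n) (j : ℤ) (k : ℕ) (hk : (k : ℤ) ≤ 2 * n - 2 * j) :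
    (T.step)^[k] (start n .south j) = ⟨.south, j - 2 * n + k, j⟩ :=
  T.iterate_south _ _ _ fun m hm h => by
    have := T.ones_bounds h
    omega

theorem iterate_start_eq_rowStart (T : PermTableauB n) {j : ℤ} (h : -(n : ℤ) ≤ j) :
    (T.step)^[(n + j).toNat] (start n .east j) = rowStart n j := by
  rw [iterate_start_east _ _ _ (by omega)]
  simp only [rowStart, ZState.mk.injEq, true_and]
  omega

theorem iterate_start_eq_colStart (T : PermTableauB n) {j : ℤ} (h2 : j ≤ n) :
    (T.step)^[(n - j).toNat] (start n .south j) = colStart n j := by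
  rw [iterate_start_south _ _ _ (by omega)]
  simp only [colStart, ZState.mk.injEq, true_and, and_true]
  omega

theorem endLabel_start_east (T : PermTableauB n) {j : ℤ} (h : -(n : ℤ) ≤ j) (h' : j ≤ n) :
    T.endLabel (start n .east j) = T.endLabel (rowStart n j) := by
  rw [← T.iterate_start_eq_rowStart h, endLabel_iterate _ _ (by rw [start_diff]; omega)]

theorem endLabel_start_south (T : PermTableauB n) {j : ℤ} (h1 : 0 ≤ j) (h2 : j ≤ n) :
    T.endLabel (start n .south j) = T.endLabel (colStart n j) := by
  rw [← T.iterate_start_eq_colStart h2, endLabel_iterate _ _ (by rw [start_diff]; omega)]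

/-- The path that enters `(r, c)` in the direction `d'` comes from a row (`d = east`) or from a
column (`d = south`). -/
def From (T : PermTableauB n) (d d' : Dir) (r c : ℤ) : Prop :=
  ∃ j, T.IsLabel d j ∧ ∃ k : ℕ, (T.step)^[k] (start n d j) = ⟨d', r, c⟩

theorem fromRow_iff (T : PermTableauB n) (d : Dir) {r c : ℤ} (hc : c ≤ n) :
    T.FromRow d r c ↔ T.From .east d r c := by
  constructor
  · rintro ⟨j, h1, k, h2⟩
    refine ⟨j, h1, k + (n + j).toNat, ?_⟩
    rw [Function.iterate_add_apply, iterate_start_eq_rowStart _ (T.isRowLabel_bounds h1).1, h2]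
  · rintro ⟨j, h1, k, h2⟩
    refine ⟨j, h1, k - (n + j).toNat, ?_⟩
    have h3 := T.isRowLabel_bounds h1
    rw [← T.iterate_start_eq_rowStart h3.1, ← Function.iterate_add_apply, Nat.sub_add_cancel, h2]
    -- Before reaching `rowStart` the prolonged path is in columns beyond `n`, but the given place
    -- has `c ≤ n`.
    by_contra h4
    rw [T.iterate_start_east j k (by omega)] at h2
    simp only [ZState.mk.injEq] at h2
    omega

theorem fromCol_iff (T : PermTableauB n) (d : Dir) {r c : ℤ} (hr : -(n : ℤ) ≤ r) :
    T.FromCol d r c ↔ T.From .south d r c := by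
  constructor
  · rintro ⟨j, h1, k, h2⟩
    have h3 := T.mem_cols_bounds h1
    refine ⟨j, h1, k + (n - j).toNat, ?_⟩
    rw [Function.iterate_add_apply, iterate_start_eq_colStart _ h3.2, h2]
  · rintro ⟨j, h1, k, h2⟩
    have h3 := T.mem_cols_bounds h1
    refine ⟨j, h1, k - (n - j).toNat, ?_⟩
    rw [← T.iterate_start_eq_colStart h3.2, ← Function.iterate_add_apply,
      Nat.sub_add_cancel, h2]
    by_contra h4
    rw [T.iterate_start_south j k (by omega)] at h2
    simp only [ZState.mk.injEq] at h2
    omega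

theorem exists_step_eq (T : PermTableauB n) {s : ZState} (h : T.Valid s) :
    ∃ s', T.Valid s' ∧ T.step s' = s := by
  obtain ⟨d, r, c⟩ := s
  cases d
  · by_cases h1 : (r, c + 1) ∈ T.ones
    · exact ⟨⟨.south, r, c + 1⟩, (T.ones_bounds h1).2.1, by simp [step, h1]⟩
    · exact ⟨⟨.east, r, c + 1⟩, h, by simp [step, h1]⟩
  · by_cases h1 : (r - 1, c) ∈ T.ones
    · exact ⟨⟨.east, r - 1, c⟩, (T.ones_bounds h1).1, by simp [step, h1]⟩
    · exact ⟨⟨.south, r - 1, c⟩, h, by simp [step, h1]⟩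

/-- Steps can be undone within valid positions, so tracing backwards up to the line `col - row = 2 *
n` arrives at a start. -/
theorem exists_start (T : PermTableauB n) {s : ZState} (h : T.Valid s)
    (hs : s.col - s.row ≤ 2 * n) :
    ∃ d j, T.IsLabel d j ∧ ∃ k : ℕ, (T.step)^[k] (start n d j) = s := by
  obtain ⟨m, hm⟩ : ∃ m : ℕ, s.col - s.row = 2 * n - m :=
    ⟨(2 * n - (s.col - s.row)).toNat, by omega⟩
  induction m generalizing s with
  | zero =>
    obtain ⟨d, r, c⟩ := s
    simp only at hm
    cases d
    · exact ⟨.east, r, h, 0, by simp [start]; omega⟩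
    · exact ⟨.south, c, h, 0, by simp [start]; omega⟩
  | succ m ih =>
    obtain ⟨s', h1, h2⟩ := T.exists_step_eq h
    have h3 := T.step_diff s'
    rw [h2] at h3
    push_cast at hm
    obtain ⟨d, j, h4, k, h5⟩ := ih h1 (by omega) (by omega)
    exact ⟨d, j, h4, k + 1, by rw [Function.iterate_succ_apply', h5, h2]⟩

theorem iterate_col_le (T : PermTableauB n) (s : ZState) (k : ℕ) :
    ((T.step)^[k] s).col ≤ s.col := by
  induction k with
  | zero => rfl
  | succ k ih =>
    rw [Function.iterate_succ_apply']
    refine le_trans ?_ ih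
    generalize (T.step)^[k] s = s'
    obtain ⟨d, r, c⟩ := s'
    cases d <;> simp only [step] <;> split_ifs <;> simp

theorem le_iterate_row (T : PermTableauB n) (s : ZState) (k : ℕ) :
    s.row ≤ ((T.step)^[k] s).row := by
  induction k with
  | zero => rfl
  | succ k ih =>
    rw [Function.iterate_succ_apply']
    refine le_trans ih ?_
    generalize (T.step)^[k] s = s'
    obtain ⟨d, r, c⟩ := s'
    cases d <;> simp only [step] <;> split_ifs <;> simp

theorem row_le_endLabel (T : PermTableauB n) (s : ZState) : s.row ≤ T.endLabel s :=
  T.le_iterate_row s _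

theorem endLabel_le_col (T : PermTableauB n) {s : ZState} (h : s.row ≤ s.col) :
    T.endLabel s ≤ s.col := by
  have h1 := T.iterate_col_le s (s.col - s.row).toNat
  have h2 := T.iterate_diff s (s.col - s.row).toNat
  unfold endLabel
  omega

/-- A path that has left the diagram at the right end of a staircase row. -/
theorem endLabel_east_of_lt (T : PermTableauB n) {r c : ℤ} (h : r < -c) :
    T.endLabel ⟨.east, r, c⟩ = r := by
  unfold endLabel
  rw [T.iterate_east]
  intro m hm h1
  have := T.ones_bounds h1
  omega

/-- Above the diagonal a column has no `1`, so no path can have turned into it there. -/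
theorem eq_start_south (T : PermTableauB n) {d : Dir} {j r c : ℤ} {k : ℕ} (h : r < -c)
    (hk : (T.step)^[k] (start n d j) = ⟨.south, r, c⟩) :
    d = .south ∧ j = c := by
  have h1 := T.iterate_diff (start n d j) k
  rw [hk, start_diff] at h1
  simp only at h1
  have h2 := T.iterate_start_south c k (by omega)
  have h3 : (⟨.south, c - 2 * n + k, c⟩ : ZState) = ⟨.south, r, c⟩ := by
    simp only [ZState.mk.injEq, true_and, and_true]
    omega
  rw [h3, ← hk] at h2
  exact (start_injective (T.step_injective.iterate k h2)).imp Eq.symm Eq.symm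

/-- A crossing outside the diagram lies above the diagonal of its column: there the path going south
is still the path of that column `i`, and the other one has left a staircase row and ends at `r <
-i`. At a box, `-i ≤ -c ≤ r`, and paths never move up. -/
theorem Cross.isBox_iff {T : PermTableauB n} {d d' : Dir} {i j r c : ℤ} (hi : T.IsLabel d i)
    (hj : T.IsLabel d' j) (h : T.Cross (start n d i) (start n d' j) r c) :
    IsBox n T.cols r c ↔ (d = .south → -i ≤ T.endLabel (start n d' j)) := by
  obtain ⟨h1, h2, k, h3, h4⟩ := h
  have hr : IsRowLabel n T.cols r := by
    have := T.valid_iterate (T.valid_start hj) k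
    rwa [h4] at this
  have hc : c ∈ T.cols := by
    have := T.valid_iterate (T.valid_start hi) k
    rwa [h3] at this
  have hr' := T.isRowLabel_bounds hr
  have hc' := T.mem_cols_bounds hc
  have h5 := T.iterate_diff (start n d i) k
  rw [h3, start_diff] at h5
  simp only at h5
  have h6 := T.endLabel_iterate (s := start n d' j) k (by rw [start_diff]; omega)
  rw [h4] at h6
  rw [← h6]
  constructor
  · rintro ⟨-, -, h7⟩ rfl
    have h8 := T.row_le_endLabel ⟨.east, r, c⟩
    have h9 := T.iterate_col_le (start n .south i) k
    rw [h3] at h9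
    simp only [start] at h8 h9
    have := (abs_le.1 h7).1
    omega
  · intro h7
    refine ⟨hr, hc, ?_⟩
    by_contra h8
    have h9 : r < -c := by
      rw [abs_le] at h8
      omega
    obtain ⟨rfl, rfl⟩ := T.eq_start_south h9 h3
    have := h7 rfl
    rw [T.endLabel_east_of_lt h9] at this
    omega

/-- The `0`s that are crossed south by a path of kind `d`, and east by a path of kind `d'`. -/
def zeros (T : PermTableauB n) (d d' : Dir) : Set (ℤ × ℤ) :=
  {b | T.IsZero b.1 b.2 ∧ T.From d .south b.1 b.2 ∧ T.From d' .east b.1 b.2}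

/-- The pairs of paths of kinds `d` and `d'` which cross in a box of the diagram. -/
def crossings (T : PermTableauB n) (d d' : Dir) : Set (ℤ × ℤ) :=
  {p | T.IsLabel d p.1 ∧ T.IsLabel d' p.2 ∧ (start n d p.1).rank < (start n d' p.2).rank ∧
    T.endLabel (start n d' p.2) < T.endLabel (start n d p.1) ∧
    (d = .south → -p.1 ≤ T.endLabel (start n d' p.2))}

theorem _root_.Set.ncard_eq_of_rel {α β : Type*} {A : Set α} {B : Set β} (R : α → β → Prop)
    (h1 : ∀ a ∈ A, ∃ b ∈ B, R a b) (h2 : ∀ b ∈ B, ∃ a ∈ A, R a b)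
    (h3 : ∀ a b b', R a b → R a b' → a ∈ A → b = b')
    (h4 : ∀ a a' b, R a b → R a' b → a = a') : A.ncard = B.ncard := by
  choose f hf using h1
  refine Set.ncard_congr f (fun a ha => (hf a ha).1) ?_ ?_
  · intro a a' ha ha' h
    exact h4 a a' (f a ha) (hf a ha).2 (by rw [h]; exact (hf a' ha').2)
  · intro b hb
    obtain ⟨a, ha, hab⟩ := h2 b hb
    exact ⟨a, ha, h3 a _ _ (hf a ha).2 hab ha⟩

theorem isBox_bounds (T : PermTableauB n) {r c : ℤ} (h : IsBox n T.cols r c) :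
    -(n : ℤ) ≤ r ∧ c ≤ n ∧ r < c := by
  obtain ⟨h1, h2, h3⟩ := h
  have h4 := T.isRowLabel_bounds h1
  refine ⟨h4.1, (T.mem_cols_bounds h2).2, lt_of_le_of_ne (abs_le.1 h3).2 ?_⟩
  rintro rfl
  exact h4.2.2.2 h2

/-- The bijection sends a pair of paths whose ends reverse the order of their starts to its unique
crossing; the last condition in `crossings` selects the crossings at boxes. -/
theorem ncard_crossings (T : PermTableauB n) (d d' : Dir) :
    (T.crossings d d').ncard = (T.zeros d d').ncard := by
  refine Set.ncard_eq_of_rel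
    (fun p b => T.Cross (start n d p.1) (start n d' p.2) b.1 b.2) ?_ ?_ ?_ ?_
  · rintro ⟨i, j⟩ ⟨h1, h2, h3, h4, h5⟩
    simp only at h1 h2 h3 h4 h5
    obtain ⟨r, c, h6⟩ := T.exists_cross (T.valid_start h1) (T.valid_start h2)
      (by rw [start_diff, start_diff]) (by have := start_diff (n := n) d i; omega) h3 h4
    refine ⟨(r, c), ⟨⟨(h6.isBox_iff h1 h2).2 h5, h6.2.1⟩, ?_, ?_⟩, h6⟩
    · exact ⟨i, h1, h6.2.2.imp fun k hk => hk.1⟩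
    · exact ⟨j, h2, h6.2.2.imp fun k hk => hk.2⟩
  · rintro ⟨r, c⟩ ⟨⟨h1, h2⟩, ⟨i, h3, k, h4⟩, ⟨j, h5, l, h6⟩⟩
    simp only at h1 h2 h4 h6
    -- Both paths begin on the same line and lose one unit of `col - row` per step, so they arrive
    -- at the same time.
    have hkl : k = l := by
      have h7 := T.iterate_diff (start n d i) k
      have h8 := T.iterate_diff (start n d' j) l
      rw [h4, start_diff] at h7
      rw [h6, start_diff] at h8
      simp only at h7 h8
      omega
    subst hkl
    have h7 : T.Cross (start n d i) (start n d' j) r c :=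
      ⟨(T.isBox_bounds h1).2.2, h2, k, h4, h6⟩
    have hd : (start n d i).col - (start n d i).row = (start n d' j).col - (start n d' j).row := by
      rw [start_diff, start_diff]
    refine ⟨(i, j), ⟨h3, h5, ?_, ?_, (h7.isBox_iff h3 h5).1 h1⟩, h7⟩
    · refine h7.rank_lt (T.valid_start h3) (T.valid_start h5) hd fun h8 => ?_
      simp only at h8
      rw [h8, h6] at h4
      simp at h4
    · exact h7.endLabel_lt (T.valid_start h3) (T.valid_start h5) hd
  · rintro ⟨i, j⟩ ⟨r, c⟩ ⟨r', c'⟩ h h' ⟨h1, h2, -⟩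
    obtain ⟨h3, h4⟩ := h.unique (T.valid_start h1) (T.valid_start h2)
      (by rw [start_diff, start_diff]) h'
    simp only at h3 h4
    rw [h3, h4]
  · rintro ⟨i, j⟩ ⟨i', j'⟩ ⟨r, c⟩ ⟨-, -, k, h1, h2⟩ ⟨-, -, l, h3, h4⟩
    simp only at h1 h2 h3 h4
    have hkl : k = l := by
      have h7 := T.iterate_diff (start n d i) k
      have h8 := T.iterate_diff (start n d i') l
      rw [h1, start_diff] at h7
      rw [h3, start_diff] at h8
      omega
    subst hkl
    rw [(start_injective (T.step_injective.iterate k (h1.trans h3.symm))).2,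
      (start_injective (T.step_injective.iterate k (h2.trans h4.symm))).2]

/-- The set of all boxes. -/
def boxes (T : PermTableauB n) : Set (ℤ × ℤ) := {b | IsBox n T.cols b.1 b.2}

theorem finite_boxes (T : PermTableauB n) : T.boxes.Finite := by
  refine (Set.finite_Icc (-(n : ℤ), -(n : ℤ)) (n, n)).subset ?_
  rintro ⟨r, c⟩ h
  have h1 := T.isBox_bounds h
  have h2 := T.mem_cols_bounds h.2.1
  simp only [Set.mem_Icc, Prod.mk_le_mk]
  omega

theorem zeroEE_eq (T : PermTableauB n) : T.zeroEE = (T.crossings .east .east).ncard := by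
  rw [ncard_crossings, zeroEE]
  congr 1
  ext ⟨r, c⟩
  simp only [zeros, Set.mem_ofPred_eq]
  refine and_congr_right fun h => ?_
  have h1 := T.isBox_bounds h.1
  rw [T.fromRow_iff _ h1.2.1, T.fromRow_iff _ h1.2.1, and_comm]

theorem zeroNN_eq (T : PermTableauB n) : T.zeroNN = (T.crossings .south .south).ncard := by
  rw [ncard_crossings, zeroNN]
  congr 1
  ext ⟨r, c⟩
  simp only [zeros, Set.mem_ofPred_eq]
  refine and_congr_right fun h => ?_
  have h1 := T.isBox_bounds h.1
  rw [T.fromCol_iff _ h1.1, T.fromCol_iff _ h1.1, and_comm]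

theorem From.unique {T : PermTableauB n} {d e d' : Dir} {r c : ℤ} (h : T.From d d' r c)
    (h' : T.From e d' r c) : d = e := by
  obtain ⟨i, -, k, h1⟩ := h
  obtain ⟨j, -, l, h2⟩ := h'
  have hkl : k = l := by
    have h7 := T.iterate_diff (start n d i) k
    have h8 := T.iterate_diff (start n e j) l
    rw [h1, start_diff] at h7
    rw [h2, start_diff] at h8
    omega
  subst hkl
  exact (start_injective (T.step_injective.iterate k (h1.trans h2.symm))).1

/-- Such a crossing would need a row path starting northeast of a column path. Rows start at columns
at least `n`, and at equal columns the eastward rank is larger. -/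
theorem zeros_east_south (T : PermTableauB n) : T.zeros .east .south = ∅ := by
  rw [← Set.ncard_eq_zero (T.finite_boxes.subset fun b hb => hb.1.1), ← ncard_crossings]
  · convert Set.ncard_empty (ℤ × ℤ)
    ext ⟨i, j⟩
    simp only [crossings, Set.mem_ofPred_eq, Set.mem_empty_iff_false, iff_false]
    rintro ⟨h1, h2, h3, -⟩
    have h4 := T.isRowLabel_bounds h1
    have h5 := T.mem_cols_bounds h2
    simp only [start, ZState.rank] at h3
    omega

/-- Tracing back the two paths through a `0` sorts the zeros by the kinds of their starts; one of
the four kinds is empty. -/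
theorem ncard_boxes (T : PermTableauB n) :
    T.boxes.ncard = T.one + T.zeroEE + T.zeroNN + (T.crossings .south .east).ncard := by
  have hfin : ∀ d d', (T.zeros d d').Finite := fun d d' =>
    T.finite_boxes.subset fun b hb => hb.1.1
  have h : T.boxes = ((T.ones : Set (ℤ × ℤ)) ∪ T.zeros .east .east ∪ T.zeros .south .south) ∪
      T.zeros .south .east := by
    ext ⟨r, c⟩
    simp only [Set.mem_union, Finset.mem_coe]
    constructor
    · intro hb
      by_cases h1 : (r, c) ∈ T.ones
      · exact Or.inl (Or.inl (Or.inl h1))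
      have h2 := T.isBox_bounds hb
      have h3 := T.mem_cols_bounds hb.2.1
      obtain ⟨d, i, hi⟩ := T.exists_start (s := ⟨.south, r, c⟩) hb.2.1 (by simp only; omega)
      obtain ⟨d', j, hj⟩ := T.exists_start (s := ⟨.east, r, c⟩) hb.1 (by simp only; omega)
      have h4 : (r, c) ∈ T.zeros d d' := ⟨⟨hb, h1⟩, ⟨i, hi⟩, ⟨j, hj⟩⟩
      cases d <;> cases d'
      · exact Or.inl (Or.inl (Or.inr h4))
      · rw [zeros_east_south] at h4
        exact absurd h4 (Set.notMem_empty _)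
      · exact Or.inr h4
      · exact Or.inl (Or.inr h4)
    · rintro (((h1 | h1) | h1) | h1)
      · exact T.ones_isBox r c h1
      · exact h1.1.1
      · exact h1.1.1
      · exact h1.1.1
  have hdis : ∀ d d' e e', (d, d') ≠ (e, e') → Disjoint (T.zeros d d') (T.zeros e e') := by
    intro d d' e e' hne
    rw [Set.disjoint_left]
    intro b hb hb'
    exact hne (Prod.ext (hb.2.1.unique hb'.2.1) (hb.2.2.unique hb'.2.2))
  have hone : ∀ d d', Disjoint (T.ones : Set (ℤ × ℤ)) (T.zeros d d') := by
    intro d d'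
    rw [Set.disjoint_left]
    exact fun b hb hb' => hb'.1.2 hb
  rw [h, Set.ncard_union_eq _ _ (hfin _ _), Set.ncard_union_eq _ _ (hfin _ _),
    Set.ncard_union_eq (hone _ _) T.ones.finite_toSet (hfin _ _), Set.ncard_coe_finset, zeroEE_eq,
    zeroNN_eq, ncard_crossings, ncard_crossings, ncard_crossings, one]
  · exact Set.disjoint_union_left.2 ⟨hone _ _, hdis _ _ _ _ (by simp)⟩
  · exact T.ones.finite_toSet.union (hfin _ _)
  · exact Set.disjoint_union_left.2 ⟨Set.disjoint_union_left.2 ⟨hone _ _, hdis _ _ _ _ (by simp)⟩,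
      hdis _ _ _ _ (by simp)⟩
  · exact (T.ones.finite_toSet.union (hfin _ _)).union (hfin _ _)

end PermTableauB

/-! ### Inversions and the statistics of tableaux -/

namespace SignedPerm

variable {n : ℕ}

/-- A signed permutation as a map on integers, with value `0` outside of `[±n]`. -/
noncomputable def toInt (σ : SignedPerm n) (z : ℤ) : ℤ :=
  if h : z ≠ 0 ∧ -(n : ℤ) ≤ z ∧ z ≤ n then (σ.1 ⟨z, h⟩).1 else 0

theorem toInt_coe (σ : SignedPerm n) (x : PM n) : toInt σ x.1 = (σ.1 x).1 := by
  rw [toInt, dif_pos x.2]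

theorem toInt_neg (σ : SignedPerm n) (z : ℤ) : toInt σ (-z) = -toInt σ z := by
  by_cases h : z ≠ 0 ∧ -(n : ℤ) ≤ z ∧ z ≤ n
  · have h1 := σ.2 ⟨z, h⟩
    have h2 : toInt σ (-z) = (σ.1 (-⟨z, h⟩)).1 := toInt_coe σ (-⟨z, h⟩)
    rw [h2, h1, PM.val_neg, ← toInt_coe]
  · rw [toInt, toInt, dif_neg h, dif_neg (by omega), neg_zero]

theorem toInt_bounds (σ : SignedPerm n) {z : ℤ} (h : z ≠ 0 ∧ -(n : ℤ) ≤ z ∧ z ≤ n) :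
    toInt σ z ≠ 0 ∧ -(n : ℤ) ≤ toInt σ z ∧ toInt σ z ≤ n := by
  rw [toInt, dif_pos h]
  exact (σ.1 ⟨z, h⟩).2

theorem toInt_injective (σ : SignedPerm n) {z w : ℤ} (hz : z ≠ 0 ∧ -(n : ℤ) ≤ z ∧ z ≤ n)
    (hw : w ≠ 0 ∧ -(n : ℤ) ≤ w ∧ w ≤ n) (h : toInt σ z = toInt σ w) : z = w := by
  rw [toInt, toInt, dif_pos hz, dif_pos hw] at h
  exact congrArg Subtype.val (σ.1.injective (Subtype.ext h))

theorem ext_toInt {σ τ : SignedPerm n} (h : ∀ z : ℤ, 1 ≤ z → z ≤ n → toInt σ z = toInt τ z) : σ = τ := by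
  apply Subtype.ext
  apply Equiv.ext
  intro x
  apply Subtype.ext
  rw [← toInt_coe, ← toInt_coe]
  have hx := x.2
  rcases lt_or_gt_of_ne hx.1 with h1 | h1
  · have := h (-x.1) (by omega) (by omega)
    rw [toInt_neg, toInt_neg] at this
    omega
  · exact h _ (by omega) (by omega)

theorem card_filter_pos (P : PM n × PM n → Prop) [DecidablePred P] (Q : ℤ → ℤ → Prop)
    [∀ i j, Decidable (Q i j)]
    (hP : ∀ p, P p ↔ 0 < p.1.1 ∧ 0 < p.2.1 ∧ Q p.1.1 p.2.1) :
    ((Finset.univ.filter P).card : ℤ) =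
      ∑ i ∈ Finset.Icc 1 (n : ℤ), ∑ j ∈ Finset.Icc 1 (n : ℤ), if Q i j then 1 else 0 := by
  rw [← Finset.sum_product', ← Finset.sum_filter, Finset.sum_const, nsmul_eq_mul, mul_one]
  norm_cast
  refine Finset.card_bij (fun p _ => (p.1.1, p.2.1)) ?_ ?_ ?_
  · intro p hp
    have h1 := p.1.2
    have h2 := p.2.2
    simp only [Finset.mem_filter, Finset.mem_univ, true_and, hP] at hp
    simp only [Finset.mem_filter, Finset.mem_product, Finset.mem_Icc]
    exact ⟨⟨⟨by omega, by omega⟩, by omega, by omega⟩, hp.2.2⟩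
  · intro p _ q _ h
    simp only [Prod.mk.injEq] at h
    exact Prod.ext (Subtype.ext h.1) (Subtype.ext h.2)
  · rintro ⟨i, j⟩ h
    simp only [Finset.mem_filter, Finset.mem_product, Finset.mem_Icc] at h
    refine ⟨(⟨i, by omega⟩, ⟨j, by omega⟩), ?_, rfl⟩
    simp only [Finset.mem_filter, Finset.mem_univ, true_and, hP]
    exact ⟨by omega, by omega, h.2⟩

theorem inv_eq_sum (σ : SignedPerm n) :
    (inv σ : ℤ) = ∑ i ∈ Finset.Icc 1 (n : ℤ), ∑ j ∈ Finset.Icc 1 (n : ℤ),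
      ((if i < j ∧ toInt σ j < toInt σ i then 1 else 0) +
        if i ≤ j ∧ toInt σ j < -toInt σ i then 1 else 0) := by
  simp only [Finset.sum_add_distrib]
  rw [inv, Nat.cast_add, card_filter_pos _ (fun i j => i < j ∧ toInt σ j < toInt σ i),
    card_filter_pos _ (fun i j => i ≤ j ∧ toInt σ j < -toInt σ i)]
  · intro p
    rw [← toInt_neg, ← PM.val_neg, toInt_coe, toInt_coe, Subtype.coe_lt_coe, Subtype.coe_le_coe]
    refine and_congr_right fun h => ⟨fun h1 => ⟨lt_of_lt_of_le h h1.1, h1⟩, fun h1 => h1.2⟩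
  · intro p
    simp only [toInt_coe, Subtype.coe_lt_coe]
    refine and_congr_right fun h => ⟨fun h1 => ⟨lt_trans h h1.1, h1⟩, fun h1 => h1.2⟩

end SignedPerm

/-- This allows double sums to be compared on unordered pairs, where the terms for `(i, j)` and `(j,
i)` need not match individually. -/
theorem Finset.sum_sum_eq_of_symm {ι : Type*} (s : Finset ι) (F G : ι → ι → ℤ)
    (h : ∀ i ∈ s, ∀ j ∈ s, F i j + F j i = G i j + G j i) :
    ∑ i ∈ s, ∑ j ∈ s, F i j = ∑ i ∈ s, ∑ j ∈ s, G i j := by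
  have key : ∀ H : ι → ι → ℤ, ∑ i ∈ s, ∑ j ∈ s, (H i j + H j i) =
      2 * ∑ i ∈ s, ∑ j ∈ s, H i j := by
    intro H
    simp only [Finset.sum_add_distrib]
    rw [Finset.sum_comm (f := fun i j => H j i)]
    ring
  have h1 := key F
  rw [Finset.sum_congr rfl fun i hi => Finset.sum_congr rfl fun j hj => h i hi j hj, key G] at h1
  linarith

namespace PermTableauB

variable {n : ℕ}

theorem toInt_zeta (T : PermTableauB n) {i : ℤ} (h1 : 1 ≤ i) (h2 : i ≤ n) :
    SignedPerm.toInt T.zeta i = T.zetaPos i := by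
  rw [SignedPerm.toInt, dif_pos (by omega)]
  change T.zetaFun i = _
  rw [zetaFun, if_pos (by omega)]

/-- The label of the row (`d = east`) or column (`d = south`) that belongs to `i ∈ [n]`. -/
def label (T : PermTableauB n) (d : Dir) (i : ℤ) : ℤ :=
  match d with
  | .east => if i ∈ T.cols then -i else i
  | .south => i

/-- Each `label d` is injective on `[n]` and reaches every label of its kind, so sets of pairs of
labels become sums over `[n]²`. -/
theorem ncard_eq_sum (T : PermTableauB n) (d d' : Dir) (A : Set (ℤ × ℤ))
    [DecidablePred (· ∈ A)] (hA : ∀ p ∈ A, T.IsLabel d p.1 ∧ T.IsLabel d' p.2) :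
    (A.ncard : ℤ) = ∑ i ∈ Finset.Icc 1 (n : ℤ), ∑ j ∈ Finset.Icc 1 (n : ℤ),
      if (T.label d i, T.label d' j) ∈ A then 1 else 0 := by
  have hinj : ∀ d i i', i ∈ Finset.Icc 1 (n : ℤ) → i' ∈ Finset.Icc 1 (n : ℤ) →
      T.label d i = T.label d i' → i = i' := by
    intro d i i' hi hi' h
    rw [Finset.mem_Icc] at hi hi'
    cases d <;> simp only [label] at h
    · split_ifs at h <;> omega
    · exact h
  have hsurj : ∀ d j, T.IsLabel d j → ∃ i ∈ Finset.Icc 1 (n : ℤ), T.label d i = j := by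
    intro d j h
    cases d
    · rcases h with h | h
      · exact ⟨j, Finset.mem_Icc.2 ⟨h.1, h.2.1⟩, if_neg h.2.2⟩
      · exact ⟨-j, Finset.mem_Icc.2 (T.mem_cols_bounds h), by simp [label, h]⟩
    · exact ⟨j, Finset.mem_Icc.2 (T.mem_cols_bounds h), rfl⟩
  rw [← Finset.sum_product', ← Finset.sum_filter, Finset.sum_const, nsmul_eq_mul, mul_one]
  norm_cast
  rw [← Set.ncard_coe_finset]
  symm
  refine Set.ncard_congr (fun p _ => (T.label d p.1, T.label d' p.2)) ?_ ?_ ?_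
  · intro p hp
    exact (Finset.mem_filter.1 hp).2
  · intro p q hp hq h
    have hp := Finset.mem_product.1 (Finset.mem_filter.1 hp).1
    have hq := Finset.mem_product.1 (Finset.mem_filter.1 hq).1
    simp only [Prod.mk.injEq] at h
    exact Prod.ext (hinj d _ _ hp.1 hq.1 h.1) (hinj d' _ _ hp.2 hq.2 h.2)
  · rintro ⟨a, b⟩ h
    obtain ⟨i, hi, h1⟩ := hsurj d a (hA _ h).1
    obtain ⟨j, hj, h2⟩ := hsurj d' b (hA _ h).2
    refine ⟨(i, j), Finset.mem_coe.2 (Finset.mem_filter.2 ⟨Finset.mem_product.2 ⟨hi, hj⟩, ?_⟩), ?_⟩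
    · simpa only [h1, h2] using h
    · simp only [h1, h2]

/-- The end of the path from the row that belongs to `i ∈ [n]`. -/
def rowEnd (T : PermTableauB n) (i : ℤ) : ℤ := T.endLabel (start n .east (T.label .east i))

/-- The end of the path from column `i`. -/
def colEnd (T : PermTableauB n) (i : ℤ) : ℤ := T.endLabel (start n .south i)

theorem endLabel_row_of_diag_zero (T : PermTableauB n) {i : ℤ} (h : i ∈ T.cols)
    (h1 : (-i, i) ∉ T.ones) : T.endLabel (rowStart n (-i)) = -i := by
  unfold endLabel rowStart
  rw [T.iterate_east]
  intro m _
  exact T.diag i h h1 _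

theorem endLabel_col_of_diag_one (T : PermTableauB n) {i : ℤ} (h1 : (-i, i) ∈ T.ones) :
    T.endLabel (colStart n i) = -i := by
  have h2 := T.ones_bounds h1
  have h3 : (T.step)^[(n - i).toNat] (colStart n i) = ⟨.south, -i, i⟩ := by
    rw [colStart, T.iterate_south]
    · simp only [ZState.mk.injEq, true_and, and_true]; omega
    · intro m hm h
      have := T.ones_bounds h
      omega
  rw [← T.endLabel_iterate (s := colStart n i) (n - i).toNat (by simp only [colStart]; omega), h3,
    ← T.endLabel_step (by simp only; omega)]
  have : T.step ⟨.south, -i, i⟩ = ⟨.east, -i, i - 1⟩ := by simp [step, h1]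
  rw [this, T.endLabel_east_of_lt (by omega)]

/-- If `i` is a column, one of its two paths is trivial and ends at `-i`: the row path when the
diagonal is `0`, the column path when it is `1`. The other path carries the absolute value of
`ζ(T)(i)`. -/
theorem ends_cases (T : PermTableauB n) {i : ℤ} (h1 : 1 ≤ i) (h2 : i ≤ n) :
    (i ∉ T.cols ∧ T.zetaPos i = T.rowEnd i ∧ i ≤ T.rowEnd i) ∨
    (i ∈ T.cols ∧ T.zetaPos i = T.colEnd i ∧ 1 ≤ T.colEnd i ∧ T.colEnd i ≤ i ∧
      T.rowEnd i = -i) ∨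
    (i ∈ T.cols ∧ T.zetaPos i = -T.rowEnd i ∧ 1 ≤ T.rowEnd i ∧ T.colEnd i = -i) := by
  obtain ⟨p, hp, hp1, hp2, -⟩ := T.end_spec i h1 h2
  simp only [rowEnd, colEnd, label, zetaPos, zetaStart] at hp ⊢
  rw [T.endLabel_start_south (by omega) h2]
  by_cases h3 : i ∈ T.cols
  · simp only [h3, not_true_eq_false, if_true, if_false] at hp ⊢
    rw [T.endLabel_start_east (by omega) (by omega)]
    by_cases h4 : (-i, i) ∈ T.ones
    · simp only [h4, not_true_eq_false, if_false] at hp ⊢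
      exact Or.inr (Or.inr ⟨trivial, trivial, by omega, T.endLabel_col_of_diag_one h4⟩)
    · simp only [h4, not_false_eq_true, if_true] at hp ⊢
      refine Or.inr (Or.inl ⟨trivial, trivial, by omega, ?_, T.endLabel_row_of_diag_zero h3 h4⟩)
      exact T.endLabel_le_col (s := colStart n i) (by simp only [colStart]; omega)
  · simp only [h3, not_false_eq_true, if_true, if_false] at hp ⊢
    rw [T.endLabel_start_east (by omega) (by omega)]
    exact Or.inl ⟨trivial, rfl, T.row_le_endLabel (rowStart n i)⟩

theorem mem_crossings_east_east (T : PermTableauB n) {i j : ℤ} (hi : i ∈ Finset.Icc 1 (n : ℤ))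
    (hj : j ∈ Finset.Icc 1 (n : ℤ)) :
    (T.label .east i, T.label .east j) ∈ T.crossings .east .east ↔
      T.label .east i < T.label .east j ∧ T.rowEnd j < T.rowEnd i := by
  have h : ∀ i ∈ Finset.Icc 1 (n : ℤ), T.IsLabel .east (T.label .east i) := by
    intro i hi
    rw [Finset.mem_Icc] at hi
    simp only [IsLabel, label, IsRowLabel]
    split_ifs with h <;> simp [h, hi]
  simp only [crossings, Set.mem_ofPred_eq, h i hi, h j hj, true_and, reduceCtorEq, false_imp_iff,
    and_true, rowEnd]
  refine and_congr_left fun _ => ?_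
  simp only [start, ZState.rank]
  omega

theorem mem_crossings_south_south (T : PermTableauB n) {i j : ℤ} :
    (T.label .south i, T.label .south j) ∈ T.crossings .south .south ↔
      i ∈ T.cols ∧ j ∈ T.cols ∧ i < j ∧ T.colEnd j < T.colEnd i ∧ -i ≤ T.colEnd j := by
  simp only [crossings, Set.mem_ofPred_eq, IsLabel, label, colEnd, forall_const, start,
    ZState.rank]
  simp only [mul_lt_mul_iff_right₀ (two_pos : (0 : ℤ) < 2)]

theorem mem_crossings_south_east (T : PermTableauB n) {i j : ℤ}
    (hj : j ∈ Finset.Icc 1 (n : ℤ)) :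
    (T.label .south i, T.label .east j) ∈ T.crossings .south .east ↔
      i ∈ T.cols ∧ T.rowEnd j < T.colEnd i ∧ -i ≤ T.rowEnd j := by
  rw [Finset.mem_Icc] at hj
  have h : T.IsLabel .east (T.label .east j) := by
    simp only [IsLabel, label, IsRowLabel]
    split_ifs with h <;> simp [h, hj]
  simp only [crossings, Set.mem_ofPred_eq, h, true_and, rowEnd, colEnd, forall_const]
  refine and_congr_right fun h1 => ?_
  have h2 := T.mem_cols_bounds h1
  have h3 := T.isRowLabel_bounds h
  simp only [label] at h2 h3
  simp only [start, ZState.rank, label, and_iff_right_iff_imp]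
  omega

theorem mem_boxes_label (T : PermTableauB n) {i j : ℤ} (hi : i ∈ Finset.Icc 1 (n : ℤ)) :
    (T.label .east i, T.label .south j) ∈ T.boxes ↔ j ∈ T.cols ∧ i ≤ j := by
  rw [Finset.mem_Icc] at hi
  have h : IsRowLabel n T.cols (T.label .east i) := by
    simp only [label, IsRowLabel]
    split_ifs with h <;> simp [h, hi]
  have h1 : |T.label .east i| = i := by
    simp only [label]
    split_ifs
    · rw [abs_neg, abs_of_pos (by omega)]
    · rw [abs_of_pos (by omega)]
  simp only [boxes, Set.mem_ofPred_eq, IsBox, h, h1, true_and]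
  rfl

/-- The contribution of a pair of labels to the number of inversions. `s`, `a` and `b` are the
value of the signed permutation, the end of the row path and the end of the column path. -/
theorem pair_contribution (C : Finset ℤ) {i j s a b s' a' b' : ℤ} (hi : 1 ≤ i) (hij : i < j)
    (hs : s ≠ s') (hs' : s ≠ -s')
    (h : (i ∉ C ∧ s = a ∧ i ≤ a) ∨ (i ∈ C ∧ s = b ∧ 1 ≤ b ∧ b ≤ i ∧ a = -i) ∨
      (i ∈ C ∧ s = -a ∧ 1 ≤ a ∧ b = -i))
    (h' : (j ∉ C ∧ s' = a' ∧ j ≤ a') ∨ (j ∈ C ∧ s' = b' ∧ 1 ≤ b' ∧ b' ≤ j ∧ a' = -j) ∨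
      (j ∈ C ∧ s' = -a' ∧ 1 ≤ a' ∧ b' = -j)) :
    ((if s' < s then 1 else 0) + if s' < -s then (1 : ℤ) else 0) =
      (if j ∈ C then 1 else 0) +
      ((if (if i ∈ C then -i else i) < (if j ∈ C then -j else j) ∧ a' < a then 1 else 0) +
        if (if j ∈ C then -j else j) < (if i ∈ C then -i else i) ∧ a < a' then 1 else 0) +
      (if i ∈ C ∧ j ∈ C ∧ b' < b ∧ -i ≤ b' then 1 else 0) -
      ((if i ∈ C ∧ a' < b ∧ -i ≤ a' then 1 else 0) +
        if j ∈ C ∧ a < b' ∧ -j ≤ a then 1 else 0) := by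
  rcases h with ⟨hc, h⟩ | ⟨hc, h⟩ | ⟨hc, h⟩ <;> rcases h' with ⟨hc', h'⟩ | ⟨hc', h'⟩ | ⟨hc', h'⟩ <;>
    simp only [hc, hc', if_true, if_false, true_and, false_and] <;> split_ifs <;> omega

/-- By `ncard_boxes` this amounts to `key`, which involves only labels and ends and is verified on
pairs of indices. -/
theorem inv_zeta (T : PermTableauB n) :
    SignedPerm.inv T.zeta = 2 * (T.zeroEE + T.zeroNN) + T.one := by
  classical
  have h1 : ((T.boxes.ncard : ℕ) : ℤ) =
      (T.one + T.zeroEE + T.zeroNN + (T.crossings .south .east).ncard : ℕ) := by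
    rw [T.ncard_boxes]
  have hEE := T.ncard_eq_sum .east .east (T.crossings .east .east) fun p hp => ⟨hp.1, hp.2.1⟩
  have hNN := T.ncard_eq_sum .south .south (T.crossings .south .south)
    fun p hp => ⟨hp.1, hp.2.1⟩
  rw [← zeroEE_eq] at hEE
  rw [← zeroNN_eq] at hNN
  have hEN := T.ncard_eq_sum .south .east (T.crossings .south .east) fun p hp => ⟨hp.1, hp.2.1⟩
  have hB := T.ncard_eq_sum .east .south T.boxes fun p hp => ⟨hp.1, hp.2.1⟩
  have key : (SignedPerm.inv T.zeta : ℤ) =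
      T.boxes.ncard + T.zeroEE + T.zeroNN - (T.crossings .south .east).ncard := by
    rw [hB, hEE, hNN, hEN, SignedPerm.inv_eq_sum]
    simp only [← Finset.sum_add_distrib, ← Finset.sum_sub_distrib]
    apply Finset.sum_sum_eq_of_symm
    intro i hi j hj
    simp only [T.mem_crossings_east_east hi hj, T.mem_crossings_east_east hj hi,
      T.mem_crossings_south_south, T.mem_crossings_south_east hi, T.mem_crossings_south_east hj,
      T.mem_boxes_label hi, T.mem_boxes_label hj]
    rw [Finset.mem_Icc] at hi hj
    rw [T.toInt_zeta hi.1 hi.2, T.toInt_zeta hj.1 hj.2]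
    have hi' := T.ends_cases hi.1 hi.2
    have hj' := T.ends_cases hj.1 hj.2
    have hne : i ≠ j → T.zetaPos i ≠ T.zetaPos j ∧ T.zetaPos i ≠ -T.zetaPos j := by
      refine fun h => ⟨fun h' => h ?_, fun h' => h ?_⟩
      · exact T.abs_zetaPos_inj i j hi.1 hi.2 hj.1 hj.2 (by rw [h'])
      · exact T.abs_zetaPos_inj i j hi.1 hi.2 hj.1 hj.2 (by rw [h', abs_neg])
    -- Indicators become values of an opaque function of the proposition, so that their decidability
    -- instances no longer matter to `linarith`.
    obtain ⟨ind, hind⟩ : ∃ ind : Prop → ℤ, ∀ (p : Prop) [Decidable p],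
        (if p then (1 : ℤ) else 0) = ind p := ⟨fun p => if p then 1 else 0, fun p _ => by congr⟩
    rcases lt_trichotomy i j with h | rfl | h
    · have := pair_contribution T.cols hi.1 h (hne h.ne).1 (hne h.ne).2 hi' hj'
      simp only [h, h.le, h.not_gt, h.not_ge, true_and, and_true, false_and, and_false,
        if_false] at this ⊢
      simp only [hind] at this ⊢
      simp only [label]
      linarith
    -- For `i = j` the diagonal box counts `1`, cancelled by the mixed crossing when its entry is
    -- `0`; what remains records whether `ζ(T)(i) < 0`.
    · rcases hi' with ⟨hc, h⟩ | ⟨hc, h⟩ | ⟨hc, h⟩ <;>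
        simp only [label, hc, lt_irrefl, le_refl, true_and, false_and, and_false, if_true, if_false] <;>
        split_ifs <;> omega
    · have := pair_contribution T.cols hj.1 h (hne h.ne').1.symm
        (fun h' => (hne h.ne').2 (by omega)) hj' hi'
      simp only [h, h.le, h.not_gt, h.not_ge, true_and, and_true, false_and, and_false,
        if_false] at this ⊢
      simp only [hind] at this ⊢
      simp only [label]
      linarith
  push_cast at h1
  omega

end PermTableauB

/-! ### Injectivity of the zigzag map -/

namespace PermTableauB

variable {n : ℕ}

/-- Going down the column, the path turns east at that `1` at the latest, and column labels decrease
to the east. -/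
theorem endLabel_lt_of_exists_one (T : PermTableauB n) {r₀ r c : ℤ} (h : (r, c) ∈ T.ones)
    (hr : r₀ ≤ r) : T.endLabel ⟨.south, r₀, c⟩ < c := by
  obtain ⟨k, hk⟩ : ∃ k : ℕ, r = r₀ + k := ⟨(r - r₀).toNat, by omega⟩
  have hb := T.ones_bounds h
  induction k generalizing r₀ with
  | zero =>
    obtain rfl : r₀ = r := by push_cast at hk; omega
    have h1 : T.step ⟨.south, r₀, c⟩ = ⟨.east, r₀, c - 1⟩ := by simp [step, h]
    rw [← T.endLabel_step (by simp only; omega), h1]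
    have := T.endLabel_le_col (s := ⟨.east, r₀, c - 1⟩) (by simp only; omega)
    simp only at this
    omega
  | succ k ih =>
    push_cast at hk
    rw [← T.endLabel_step (by simp only; omega)]
    by_cases h2 : (r₀, c) ∈ T.ones
    · have h1 : T.step ⟨.south, r₀, c⟩ = ⟨.east, r₀, c - 1⟩ := by simp [step, h2]
      rw [h1]
      have := T.endLabel_le_col (s := ⟨.east, r₀, c - 1⟩) (by simp only; omega)
      simp only at this
      omega
    · have h1 : T.step ⟨.south, r₀, c⟩ = ⟨.south, r₀ + 1, c⟩ := by simp [step, h2]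
      rw [h1]
      exact ih (by omega) (by omega)

theorem colEnd_lt (T : PermTableauB n) {i : ℤ} (h : i ∈ T.cols) : T.colEnd i < i := by
  obtain ⟨r, hr⟩ := T.exists_one i h
  have h1 := T.ones_bounds hr
  exact T.endLabel_lt_of_exists_one hr (by omega)

/-- Row paths with positive labels end weakly after their own label. For columns, the condition that
every column has a `1` makes the inequality strict, via `colEnd_lt`. -/
theorem mem_cols_iff (T : PermTableauB n) {i : ℤ} (h1 : 1 ≤ i) (h2 : i ≤ n) :
    i ∈ T.cols ↔ T.zetaPos i < i := by
  rcases T.ends_cases h1 h2 with h | h | h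
  · simp only [h.1, false_iff, not_lt]
    omega
  · have := T.colEnd_lt h.1
    simp only [h.1, true_iff]
    omega
  · simp only [h.1, true_iff]
    omega

/-- For a column label `i`, the sign of `ζ(T)(i)` tells which of its two paths is trivial, so both
ends are known. -/
theorem endLabel_start_eq_of_zetaPos (T T' : PermTableauB n)
    (h : ∀ i : ℤ, 1 ≤ i → i ≤ n → T.zetaPos i = T'.zetaPos i) (hC : T.cols = T'.cols)
    {d : Dir} {j : ℤ} (hj : T.IsLabel d j) :
    T.endLabel (start n d j) = T'.endLabel (start n d j) := by
  have key : ∀ i : ℤ, 1 ≤ i → i ≤ n →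
      T.rowEnd i = T'.rowEnd i ∧ (i ∈ T.cols → T.colEnd i = T'.colEnd i) := by
    intro i h1 h2
    have h3 := T.ends_cases h1 h2
    have h4 := T'.ends_cases h1 h2
    rw [← hC, ← h i h1 h2] at h4
    by_cases hi : i ∈ T.cols
    · simp only [hi, not_true_eq_false, false_and, true_and, false_or, forall_const] at h3 h4 ⊢
      omega
    · simp only [hi, not_false_eq_true, true_and, false_and, or_false, false_imp_iff,
        and_true] at h3 h4 ⊢
      omega
  cases d
  · rcases hj with hj | hj
    · have := (key j hj.1 hj.2.1).1
      simpa only [rowEnd, label, ← hC, if_neg hj.2.2] using this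
    · have h1 := T.mem_cols_bounds hj
      have := (key (-j) h1.1 h1.2).1
      simpa only [rowEnd, label, ← hC, if_pos hj, neg_neg] using this
  · have h1 := T.mem_cols_bounds hj
    exact (key j h1.1 h1.2).2 hj

theorem endLabel_eq_of_start (T T' : PermTableauB n) (hC : T.cols = T'.cols)
    (h : ∀ d j, T.IsLabel d j → T.endLabel (start n d j) = T'.endLabel (start n d j))
    {s : ZState} (hs : T.Valid s) (h0 : s.row ≤ s.col) (h1 : s.col - s.row ≤ 2 * n) :
    T.endLabel s = T'.endLabel s := by
  obtain ⟨m, hm⟩ : ∃ m : ℕ, s.col - s.row = 2 * n - m :=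
    ⟨(2 * n - (s.col - s.row)).toNat, by omega⟩
  induction m generalizing s with
  | zero =>
    obtain ⟨d, r, c⟩ := s
    simp only at hm
    cases d
    · obtain rfl : c = r + 2 * n := by push_cast at hm; omega
      exact h .east r hs
    · obtain rfl : r = c - 2 * n := by push_cast at hm; omega
      exact h .south c hs
  | succ m ih =>
    push_cast at hm
    -- The ends on the preceding line determine the filling there, hence the step that leads to `s`.
    have hplace : ∀ r c : ℤ, r < c → c - r = 2 * n - m →
        ((r, c) ∈ T.ones ↔ (r, c) ∈ T'.ones) := by
      intro r c hrc hd
      by_cases hrow : IsRowLabel n T.cols r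
      · by_cases hcol : c ∈ T.cols
        · rw [T.mem_ones_iff hrow hcol hrc, T'.mem_ones_iff (hC ▸ hrow) (hC ▸ hcol) hrc,
            ih (s := ⟨.south, r, c⟩) hcol hrc.le (by simp only; omega) hd,
            ih (s := ⟨.east, r, c⟩) hrow hrc.le (by simp only; omega) hd]
        · exact iff_of_false (fun h => hcol (T.ones_bounds h).2.1)
            (fun h => hcol (hC ▸ (T'.ones_bounds h).2.1))
      · exact iff_of_false (fun h => hrow (T.ones_bounds h).1)
          (fun h => hrow (hC ▸ (T'.ones_bounds h).1))
    obtain ⟨s', h2, h3⟩ := T.exists_step_eq hs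
    have h4 := T.step_diff s'
    rw [h3] at h4
    have h5 : T'.step s' = s := by
      have := hplace s'.row s'.col (by omega) (by omega)
      rw [← h3]
      obtain ⟨d, r, c⟩ := s'
      cases d <;> simp only [step, this]
    rw [← h3, T.endLabel_step (by omega), h3, ← h5, T'.endLabel_step (by omega)]
    exact ih h2 (by omega) (by omega) (by omega)

theorem zeta_injective : Function.Injective (zeta (n := n)) := by
  intro T T' h
  have hz : ∀ i : ℤ, 1 ≤ i → i ≤ n → T.zetaPos i = T'.zetaPos i := by
    intro i h1 h2
    rw [← T.toInt_zeta h1 h2, ← T'.toInt_zeta h1 h2, h]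
  have hC : T.cols = T'.cols := by
    ext i
    constructor
    · intro hi
      have h1 := T.mem_cols_bounds hi
      rw [T'.mem_cols_iff h1.1 h1.2, ← hz i h1.1 h1.2, ← T.mem_cols_iff h1.1 h1.2]
      exact hi
    · intro hi
      have h1 := T'.mem_cols_bounds hi
      rw [T.mem_cols_iff h1.1 h1.2, hz i h1.1 h1.2, ← T'.mem_cols_iff h1.1 h1.2]
      exact hi
  refine PermTableauB.ext hC ?_
  have key : ∀ r c, IsRowLabel n T.cols r → c ∈ T.cols → r < c →
      ((r, c) ∈ T.ones ↔ (r, c) ∈ T'.ones) := by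
    intro r c hr hc hrc
    have h1 := T.isRowLabel_bounds hr
    have h2 := T.mem_cols_bounds hc
    have h3 : ∀ d j, T.IsLabel d j → T.endLabel (start n d j) = T'.endLabel (start n d j) :=
      fun d j hj => T.endLabel_start_eq_of_zetaPos T' hz hC hj
    rw [T.mem_ones_iff hr hc hrc, T'.mem_ones_iff (hC ▸ hr) (hC ▸ hc) hrc,
      T.endLabel_eq_of_start T' hC h3 (s := ⟨.south, r, c⟩) hc hrc.le (by simp only; omega),
      T.endLabel_eq_of_start T' hC h3 (s := ⟨.east, r, c⟩) hr hrc.le (by simp only; omega)]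
  ext ⟨r, c⟩
  constructor
  · intro h1
    have h2 := T.ones_bounds h1
    exact (key r c h2.1 h2.2.1 h2.2.2.2.2.2).1 h1
  · intro h1
    have h2 := T'.ones_bounds h1
    exact (key r c (hC ▸ h2.1) (hC ▸ h2.2.1) h2.2.2.2.2.2).2 h1

end PermTableauB

/-! ### Surjectivity of the zigzag map -/

/-- The prescribed ends of all paths: `rowEnd r` for the path from row `r`, and `colEnd c` for the
path from column `c`. -/
structure PathEnds (n : ℕ) where
  cols : Finset ℤ
  cols_bounds : ∀ c ∈ cols, 1 ≤ c ∧ c ≤ n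
  rows : Finset ℤ
  mem_rows : ∀ r, r ∈ rows ↔ IsRowLabel n cols r
  rowEnd : ℤ → ℤ
  colEnd : ℤ → ℤ
  rowEnd_mem : ∀ r ∈ rows, rowEnd r ∈ rows ∪ cols
  colEnd_mem : ∀ c ∈ cols, colEnd c ∈ rows ∪ cols
  le_rowEnd : ∀ r ∈ rows, r ≤ rowEnd r
  colEnd_lt : ∀ c ∈ cols, colEnd c < c
  neg_le_colEnd : ∀ c ∈ cols, -c ≤ colEnd c
  rowEnd_inj : ∀ r ∈ rows, ∀ r' ∈ rows, rowEnd r = rowEnd r' → r = r'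
  colEnd_inj : ∀ c ∈ cols, ∀ c' ∈ cols, colEnd c = colEnd c' → c = c'
  rowEnd_ne_colEnd : ∀ r ∈ rows, ∀ c ∈ cols, rowEnd r ≠ colEnd c
  diag : ∀ c ∈ cols, colEnd c = -c ∨ rowEnd (-c) = -c

namespace PathEnds

variable {n : ℕ}

/-- The end of the path that enters column `c` from the north above row `r`, if `v` gives the ends
of the paths that enter it from the west: the greatest of the ends of the paths met so far. -/
def carryAux (D : PathEnds n) (v : ℤ → ℤ) (c r : ℤ) : ℤ :=
  (D.rows.filter (· < r)).fold max (D.colEnd c) v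

/-- The ends of the paths that enter column `n - m` from the west. -/
def valueAux (D : PathEnds n) : ℕ → ℤ → ℤ
  | 0, r => D.rowEnd r
  | m + 1, r =>
    if (n - m : ℤ) ∈ D.cols ∧ r < n - m then
      min (D.carryAux (D.valueAux m) (n - m) r) (D.valueAux m r)
    else D.valueAux m r

/-- The end of the path that enters the place `(r, c)` moving east. -/
def value (D : PathEnds n) (c r : ℤ) : ℤ := D.valueAux (n - c).toNat r

/-- The end of the path that enters the place `(r, c)` moving south. -/
def carry (D : PathEnds n) (c r : ℤ) : ℤ := D.carryAux (D.value c) c r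

/-! ### The min-max recursion and its invariant. -/

theorem value_top (D : PathEnds n) (r : ℤ) : D.value n r = D.rowEnd r := by
  simp [value, valueAux]

theorem value_pred (D : PathEnds n) {c : ℤ} (hc : c ≤ n) (r : ℤ) :
    D.value (c - 1) r =
      if c ∈ D.cols ∧ r < c then min (D.carry c r) (D.value c r) else D.value c r := by
  obtain ⟨m, rfl⟩ : ∃ m : ℕ, c = n - m := ⟨(n - c).toNat, by omega⟩
  have h1 : (n - (n - m - 1) : ℤ).toNat = m + 1 := by omega
  have h2 : (n - (n - m) : ℤ).toNat = m := by omega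
  have h3 : D.value (n - m) = D.valueAux m := by
    funext r
    rw [value, h2]
  rw [carry, h3, value, h1, valueAux]

theorem value_pred_le (D : PathEnds n) {c : ℤ} (hc : c ≤ n) (r : ℤ) :
    D.value (c - 1) r ≤ D.value c r := by
  rw [D.value_pred hc]
  split_ifs
  · exact min_le_right _ _
  · rfl

theorem colEnd_le_carry (D : PathEnds n) (c r : ℤ) : D.colEnd c ≤ D.carry c r :=
  (Finset.le_fold_max _).2 (Or.inl le_rfl)

theorem value_le_carry (D : PathEnds n) (c : ℤ) {r r' : ℤ} (h : r ∈ D.rows) (h' : r < r') :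
    D.value c r ≤ D.carry c r' :=
  (Finset.le_fold_max _).2 (Or.inr ⟨r, Finset.mem_filter.2 ⟨h, h'⟩, le_rfl⟩)

theorem carry_le_iff (D : PathEnds n) (c r x : ℤ) :
    D.carry c r ≤ x ↔ D.colEnd c ≤ x ∧ ∀ r' ∈ D.rows, r' < r → D.value c r' ≤ x := by
  rw [carry, carryAux, Finset.fold_max_le]
  simp only [Finset.mem_filter, and_imp]

theorem carry_mono (D : PathEnds n) (c : ℤ) {r r' : ℤ} (h : r ≤ r') :
    D.carry c r ≤ D.carry c r' :=
  (D.carry_le_iff _ _ _).2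
    ⟨D.colEnd_le_carry _ _, fun _ h1 h2 => D.value_le_carry c h1 (h2.trans_le h)⟩

theorem carry_eq (D : PathEnds n) (c r : ℤ) :
    D.carry c r = D.colEnd c ∨ ∃ r' ∈ D.rows, r' < r ∧ D.carry c r = D.value c r' := by
  rcases (Finset.le_fold_max (s := D.rows.filter (· < r)) (b := D.colEnd c) (f := D.value c)
    (D.carry c r)).1 le_rfl with h | ⟨r', h1, h2⟩
  · exact Or.inl (le_antisymm h (D.colEnd_le_carry _ _))
  · obtain ⟨h3, h4⟩ := Finset.mem_filter.1 h1
    exact Or.inr ⟨r', h3, h4, le_antisymm h2 (D.value_le_carry c h3 h4)⟩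

theorem carry_succ_of_mem (D : PathEnds n) (c : ℤ) {r : ℤ} (h : r ∈ D.rows) :
    D.carry c (r + 1) = max (D.carry c r) (D.value c r) := by
  refine le_antisymm ((D.carry_le_iff _ _ _).2 ⟨?_, fun r' h1 h2 => ?_⟩)
    (max_le (D.carry_mono c (by omega)) (D.value_le_carry c h (by omega)))
  · exact le_max_of_le_left (D.colEnd_le_carry _ _)
  · rcases (show r' ≤ r by omega).eq_or_lt with rfl | h3
    · exact le_max_right _ _
    · exact le_max_of_le_left (D.value_le_carry c h1 h3)

theorem carry_succ_of_notMem (D : PathEnds n) (c : ℤ) {r : ℤ} (h : r ∉ D.rows) :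
    D.carry c (r + 1) = D.carry c r := by
  refine le_antisymm ((D.carry_le_iff _ _ _).2 ⟨D.colEnd_le_carry _ _, fun r' h1 h2 => ?_⟩)
    (D.carry_mono c (by omega))
  refine D.value_le_carry c h1 (lt_of_le_of_ne (by omega) ?_)
  rintro rfl
  exact h h1

theorem rows_bounds (D : PathEnds n) {r : ℤ} (h : r ∈ D.rows) :
    -(n : ℤ) ≤ r ∧ r ≤ n ∧ r ∉ D.cols ∧ (r < 0 → -r ∈ D.cols) := by
  rcases (D.mem_rows r).1 h with h | h
  · exact ⟨by omega, h.2.1, h.2.2, fun _ => by omega⟩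
  · have := D.cols_bounds _ h
    refine ⟨by omega, by omega, fun h' => ?_, fun _ => h⟩
    have := D.cols_bounds _ h'
    omega

theorem neg_mem_rows (D : PathEnds n) {c : ℤ} (h : c ∈ D.cols) : -c ∈ D.rows :=
  (D.mem_rows _).2 (Or.inr (by rwa [neg_neg]))

/-- What holds for the paths that enter column `c` from the west. -/
structure Good (D : PathEnds n) (c : ℤ) : Prop where
  le_value : ∀ r ∈ D.rows, r ≤ D.value c r
  value_le_rowEnd : ∀ r ∈ D.rows, D.value c r ≤ D.rowEnd r
  value_mem : ∀ r ∈ D.rows, D.value c r ∈ D.rows ∪ D.cols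
  value_inj : ∀ r ∈ D.rows, ∀ r' ∈ D.rows, D.value c r = D.value c r' → r = r'
  value_ne : ∀ r ∈ D.rows, ∀ c' ∈ D.cols, c' ≤ c → D.value c r ≠ D.colEnd c'
  value_le : ∀ r ∈ D.rows, r ≤ c → D.value c r ≤ c
  value_neg : ∀ i ∈ D.cols, c < i → D.value c (-i) = -i

/-- Pigeonhole. If the path entering `(r, c)` from the north ended before `r`, then column `c`, the
rows above `r` and all columns with labels below `r` would have distinct ends below `r`: one more
end than there are labels below `r`. -/
theorem Good.le_carry {D : PathEnds n} {c : ℤ} (h : D.Good c) (hc : c ∈ D.cols) {r : ℤ}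
    (hr : r ≤ c) : r ≤ D.carry c r := by
  by_contra! h0
  obtain ⟨h1, h2⟩ := (D.carry_le_iff c r (r - 1)).1 (by omega)
  let B := (D.rows ∪ D.cols).filter (· < r)
  have hcB : c ∉ B := fun h => by
    have := (Finset.mem_filter.1 h).2
    omega
  have hle : (insert c B).card ≤ B.card := by
    have hcases : ∀ x ∈ insert c B, (x ∈ D.cols ∧ (x = c ∨ x < r)) ∨ (x ∈ D.rows ∧ x < r) := by
      intro x hx
      rcases Finset.mem_insert.1 hx with rfl | hx
      · exact Or.inl ⟨hc, Or.inl rfl⟩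
      · obtain ⟨h3, h4⟩ := Finset.mem_filter.1 hx
        rcases Finset.mem_union.1 h3 with h3 | h3
        · exact Or.inr ⟨h3, h4⟩
        · exact Or.inl ⟨h3, Or.inr h4⟩
    refine Finset.card_le_card_of_injOn
      (fun x => if x ∈ D.cols then D.colEnd x else D.value c x) ?_ ?_
    · intro x hx
      rcases hcases x hx with ⟨h3, h4⟩ | ⟨h3, h4⟩
      · have := D.colEnd_lt x h3
        simp only [h3, if_true]
        refine Finset.mem_coe.2 (Finset.mem_filter.2 ⟨D.colEnd_mem x h3, ?_⟩)
        rcases h4 with rfl | h4 <;> omega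
      · have := h2 x h3 h4
        simp only [(D.rows_bounds h3).2.2.1, if_false]
        exact Finset.mem_coe.2 (Finset.mem_filter.2 ⟨h.value_mem x h3, by omega⟩)
    · intro x hx y hy hxy
      simp only at hxy
      rcases hcases x hx with ⟨h3, h4⟩ | ⟨h3, h4⟩ <;> rcases hcases y hy with ⟨h5, h6⟩ | ⟨h5, h6⟩
      · rw [if_pos h3, if_pos h5] at hxy
        exact D.colEnd_inj x h3 y h5 hxy
      · rw [if_pos h3, if_neg (D.rows_bounds h5).2.2.1] at hxy
        exact absurd hxy.symm (h.value_ne y h5 x h3 (by omega))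
      · rw [if_neg (D.rows_bounds h3).2.2.1, if_pos h5] at hxy
        exact absurd hxy (h.value_ne x h3 y h5 (by omega))
      · rw [if_neg (D.rows_bounds h3).2.2.1, if_neg (D.rows_bounds h5).2.2.1] at hxy
        exact h.value_inj x h3 y h5 hxy
  rw [Finset.card_insert_of_notMem hcB] at hle
  omega

theorem Good.carry_ne {D : PathEnds n} {c : ℤ} (h : D.Good c) (hc : c ∈ D.cols) {r : ℤ}
    (hr : r ∈ D.rows) : D.carry c r ≠ D.value c r := by
  rcases D.carry_eq c r with h1 | ⟨r', h1, h2, h3⟩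
  · rw [h1]
    exact (h.value_ne r hr c hc le_rfl).symm
  · rw [h3]
    exact fun h4 => h2.ne (h.value_inj r' h1 r hr h4)

theorem Good.carry_le {D : PathEnds n} {c : ℤ} (h : D.Good c) (hc : c ∈ D.cols) {r : ℤ}
    (hr : r ≤ c) : D.carry c r ≤ c :=
  (D.carry_le_iff _ _ _).2 ⟨(D.colEnd_lt c hc).le, fun r' h1 h2 => h.value_le r' h1 (by omega)⟩

/-- A path that leaves column `c` to the east ends before the path that goes on to the south. -/
theorem Good.min_lt_carry {D : PathEnds n} {c : ℤ} (h : D.Good c) (hc : c ∈ D.cols) {r r' : ℤ}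
    (hr : r ∈ D.rows) (hrr' : r < r') :
    min (D.carry c r) (D.value c r) < D.carry c r' := by
  have h1 := h.carry_ne hc hr
  have h2 := D.carry_mono c hrr'.le
  have h3 := D.value_le_carry c hr hrr'
  rcases lt_or_gt_of_ne h1 with h4 | h4
  · rw [min_eq_left h4.le]; omega
  · rw [min_eq_right h4.le]; omega

theorem good_top (D : PathEnds n) : D.Good n where
  le_value r hr := by rw [value_top]; exact D.le_rowEnd r hr
  value_le_rowEnd r _ := by rw [value_top]
  value_mem r hr := by rw [value_top]; exact D.rowEnd_mem r hr
  value_inj r hr r' hr' h := by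
    rw [value_top, value_top] at h
    exact D.rowEnd_inj r hr r' hr' h
  value_ne r hr c hc _ := by rw [value_top]; exact D.rowEnd_ne_colEnd r hr c hc
  value_le r hr _ := by
    rw [value_top]
    rcases Finset.mem_union.1 (D.rowEnd_mem r hr) with h | h
    · exact (D.rows_bounds h).2.1
    · exact (D.cols_bounds _ h).2
  value_neg i hi h := by
    have := D.cols_bounds i hi
    omega

theorem Good.pred_of_notMem {D : PathEnds n} {c : ℤ} (h : D.Good c) (hn : c ≤ n)
    (hc : c ∉ D.cols) : D.Good (c - 1) := by
  have hv : ∀ r, D.value (c - 1) r = D.value c r := by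
    intro r
    rw [D.value_pred hn, if_neg fun h => hc h.1]
  constructor <;> simp only [hv]
  · exact h.le_value
  · exact h.value_le_rowEnd
  · exact h.value_mem
  · exact h.value_inj
  · exact fun r hr c' hc' h1 => h.value_ne r hr c' hc' (by omega)
  · intro r hr h1
    have h2 := h.value_le r hr (by omega)
    -- The label `c` is already taken: if it is a row, its own path ends there.
    suffices D.value c r ≠ c by omega
    intro h3
    rcases Finset.mem_union.1 (h.value_mem r hr) with h4 | h4
    · rw [h3] at h4
      have h5 := h.le_value c h4
      have h6 := h.value_le c h4 le_rfl
      have := h.value_inj r hr c h4 (by omega)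
      omega
    · rw [h3] at h4
      exact hc h4
  · intro i hi h1
    refine h.value_neg i hi (lt_of_le_of_ne (by omega) ?_)
    rintro rfl
    exact hc hi

/-- Column `c` only redistributes the ends entering it. The outgoing ends stay distinct because each
is smaller than the running maximum passed further down. -/
theorem Good.pred_of_mem {D : PathEnds n} {c : ℤ} (h : D.Good c) (hc : c ∈ D.cols) :
    D.Good (c - 1) := by
  have hn := (D.cols_bounds c hc).2
  have hc1 := (D.cols_bounds c hc).1
  have hv1 : ∀ r, r < c → D.value (c - 1) r = min (D.carry c r) (D.value c r) := by
    intro r hr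
    rw [D.value_pred hn, if_pos ⟨hc, hr⟩]
  have hv2 : ∀ r, ¬ r < c → D.value (c - 1) r = D.value c r := by
    intro r hr
    rw [D.value_pred hn, if_neg fun h => hr h.2]
  have hne : ∀ r ∈ D.rows, r ≠ c := by
    rintro r hr rfl
    exact (D.rows_bounds hr).2.2.1 hc
  have hle : ∀ r ∈ D.rows, r ≤ D.value (c - 1) r := by
    intro r hr
    by_cases h1 : r < c
    · rw [hv1 r h1]
      exact le_min (h.le_carry hc h1.le) (h.le_value r hr)
    · rw [hv2 r h1]
      exact h.le_value r hr
  have heq : ∀ r ∈ D.rows, D.value (c - 1) r = D.colEnd c ∨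
      ∃ r' ∈ D.rows, r' ≤ r ∧ D.value (c - 1) r = D.value c r' := by
    intro r hr
    by_cases h1 : r < c
    · rw [hv1 r h1]
      rcases min_choice (D.carry c r) (D.value c r) with h2 | h2
      · rw [h2]
        exact (D.carry_eq c r).imp id fun ⟨r', h3, h4, h5⟩ => ⟨r', h3, h4.le, h5⟩
      · rw [h2]
        exact Or.inr ⟨r, hr, le_rfl, rfl⟩
    · rw [hv2 r h1]
      exact Or.inr ⟨r, hr, le_rfl, rfl⟩
  have hinj : ∀ r ∈ D.rows, ∀ r' ∈ D.rows, r < r' → D.value (c - 1) r ≠ D.value (c - 1) r' := by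
    intro r hr r' hr' hlt h1
    have h2 : D.value (c - 1) r ≠ D.value c r' := by
      rcases heq r hr with h2 | ⟨r₁, h2, h3, h4⟩
      · rw [h2]
        exact (h.value_ne r' hr' c hc le_rfl).symm
      · rw [h4]
        intro h5
        have := h.value_inj r₁ h2 r' hr' h5
        omega
    by_cases h3 : r' < c
    · rw [hv1 r' h3] at h1
      rcases min_choice (D.carry c r') (D.value c r') with h4 | h4
      · rw [h4, hv1 r (hlt.trans h3)] at h1
        exact (h.min_lt_carry hc hr hlt).ne h1
      · rw [h4] at h1
        exact h2 h1
    · rw [hv2 r' h3] at h1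
      exact h2 h1
  refine ⟨hle, ?_, ?_, ?_, ?_, ?_, ?_⟩
  · exact fun r hr => (D.value_pred_le hn r).trans (h.value_le_rowEnd r hr)
  · intro r hr
    rcases heq r hr with h1 | ⟨r', h1, -, h2⟩
    · rw [h1]
      exact D.colEnd_mem c hc
    · rw [h2]
      exact h.value_mem r' h1
  · intro r hr r' hr' h1
    by_contra h2
    rcases lt_or_gt_of_ne h2 with h3 | h3
    · exact hinj r hr r' hr' h3 h1
    · exact hinj r' hr' r hr h3 h1.symm
  · intro r hr c' hc' h1
    rcases heq r hr with h2 | ⟨r', h2, -, h3⟩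
    · rw [h2]
      intro h3
      have := D.colEnd_inj c hc c' hc' h3
      omega
    · rw [h3]
      exact h.value_ne r' h2 c' hc' (by omega)
  · intro r hr h1
    have h2 : r < c := by omega
    -- The end that leaves eastward is smaller than the one at the bottom of the column, which is at
    -- most `c`.
    have h3 := h.min_lt_carry hc hr h2
    have h4 := h.carry_le hc (le_refl c)
    rw [hv1 r h2]
    omega
  · intro i hi h1
    refine le_antisymm ?_ (hle _ (D.neg_mem_rows hi))
    rcases (show c ≤ i by omega).eq_or_lt with rfl | h2
    -- Row `-c` leaves the diagram in this column. If `colEnd c = -c`, all rows above have already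
    -- left with their own smaller labels, so the end carried down is at most `-c`; otherwise the
    -- row has kept its trivial end from the beginning.
    · rcases D.diag c hc with h3 | h3
      · rw [hv1 _ (by omega)]
        refine min_le_of_left_le ((D.carry_le_iff _ _ _).2 ⟨h3.le, fun r hr h4 => ?_⟩)
        have h5 := h.value_neg (-r) ((D.rows_bounds hr).2.2.2 (by omega)) (by omega)
        rw [neg_neg] at h5
        omega
      · have h4 := h.value_le_rowEnd _ (D.neg_mem_rows hc)
        have h5 := D.value_pred_le hn (-c)
        omega
    · have h3 := h.value_neg i hi h2
      have h4 := D.value_pred_le hn (-i)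
      omega

theorem good (D : PathEnds n) {c : ℤ} (hc : c ≤ n) : D.Good c := by
  obtain ⟨m, rfl⟩ : ∃ m : ℕ, c = n - m := ⟨(n - c).toNat, by omega⟩
  induction m with
  | zero => simpa using D.good_top
  | succ m ih =>
    have ih := ih (by omega)
    rw [show (n - (m + 1 : ℕ) : ℤ) = n - m - 1 by push_cast; ring]
    by_cases h : (n - m : ℤ) ∈ D.cols
    · exact ih.pred_of_mem h
    · exact ih.pred_of_notMem (by omega) h

/-- The places of the `1`s: two paths touch if their order agrees with the order of their ends. -/
def ones (D : PathEnds n) : Finset (ℤ × ℤ) :=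
  (D.rows ×ˢ D.cols).filter fun b => b.1 < b.2 ∧ D.carry b.2 b.1 < D.value b.2 b.1

theorem mem_ones (D : PathEnds n) {r c : ℤ} :
    (r, c) ∈ D.ones ↔ r ∈ D.rows ∧ c ∈ D.cols ∧ r < c ∧ D.carry c r < D.value c r := by
  simp only [ones, Finset.mem_filter, Finset.mem_product, and_assoc]

/-- A staircase row past its diagonal has its own label as end, which is smaller than anything
carried down column `c`. -/
theorem neg_le_of_mem_ones (D : PathEnds n) {r c : ℤ} (h : (r, c) ∈ D.ones) : -c ≤ r := by
  obtain ⟨h1, h2, h3, h4⟩ := D.mem_ones.1 h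
  by_contra h5
  have h6 := D.cols_bounds c h2
  have h7 := (D.good h6.2).value_neg (-r) ((D.rows_bounds h1).2.2.2 (by omega)) (by omega)
  rw [neg_neg] at h7
  have h8 := D.colEnd_le_carry c r
  have h9 := D.neg_le_colEnd c h2
  omega

theorem diag_mem_ones (D : PathEnds n) {c : ℤ} (hc : c ∈ D.cols) (h : D.colEnd c = -c) :
    (-c, c) ∈ D.ones := by
  have h1 := D.cols_bounds c hc
  have hg := D.good h1.2
  have hr := D.neg_mem_rows hc
  refine D.mem_ones.2 ⟨hr, hc, by omega, ?_⟩
  have h2 : D.carry c (-c) ≤ -c := by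
    refine (D.carry_le_iff _ _ _).2 ⟨h.le, fun r hr h4 => ?_⟩
    have h5 := hg.value_neg (-r) ((D.rows_bounds hr).2.2.2 (by omega)) (by omega)
    rw [neg_neg] at h5
    omega
  have h3 := hg.le_value _ hr
  have h4 := hg.carry_ne hc hr
  omega

/-- Ends in a row never increase to the east, while the end carried down to row `i` is at least `i`.
-/
theorem notMem_ones_of_rowEnd (D : PathEnds n) {i : ℤ} (h : D.rowEnd i = i) (c : ℤ) :
    (i, c) ∉ D.ones := by
  intro h0
  obtain ⟨h1, h2, h3, h4⟩ := D.mem_ones.1 h0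
  have hg := D.good (D.cols_bounds c h2).2
  have h5 := hg.value_le_rowEnd i h1
  have h6 := hg.le_carry h2 h3.le
  omega

/-- All paths that enter column `c` from the west above row `r` end before the path in row `r`. -/
def IsRecord (D : PathEnds n) (c r : ℤ) : Prop :=
  ∀ r' ∈ D.rows, r' < r → D.value c r' < D.value c r

theorem IsRecord.pred {D : PathEnds n} {c r : ℤ} (hc : c ≤ n) (h : D.IsRecord c r) :
    D.IsRecord (c - 1) r := by
  intro r' hr' hlt
  have h1 := h r' hr' hlt
  rw [D.value_pred hc r]
  split_ifs with h2
  · rw [D.value_pred hc r', if_pos ⟨h2.1, by omega⟩]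
    exact lt_min ((D.good hc).min_lt_carry h2.1 hr' hlt) (min_lt_of_right_lt h1)
  · exact (D.value_pred_le hc r').trans_lt h1

/-- At a `1` the row takes over the maximum carried down the column, which exceeds every end sent
east above it; later columns preserve this. -/
theorem isRecord_of_mem_ones (D : PathEnds n) {r c c' : ℤ} (h : (r, c') ∈ D.ones)
    (hc : c < c') : D.IsRecord c r := by
  obtain ⟨h1, h2, h3, h4⟩ := D.mem_ones.1 h
  have h5 := (D.cols_bounds _ h2).2
  obtain ⟨m, rfl⟩ : ∃ m : ℕ, c = c' - 1 - m := ⟨(c' - 1 - c).toNat, by omega⟩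
  clear hc
  induction m with
  | zero =>
    simp only [Nat.cast_zero, sub_zero]
    intro r' hr' hlt
    rw [D.value_pred h5, D.value_pred h5, if_pos ⟨h2, by omega⟩, if_pos ⟨h2, h3⟩,
      min_eq_left h4.le]
    exact (D.good h5).min_lt_carry h2 hr' hlt
  | succ m ih =>
    have := ih.pred (by omega)
    rwa [show (c' - 1 - m - 1 : ℤ) = c' - 1 - (m + 1 : ℕ) by push_cast; ring] at this

/-- The tableau whose paths have the prescribed ends. -/
def tableau (D : PathEnds n) : PermTableauB n where
  cols := D.cols
  cols_subset c hc := Finset.mem_Icc.2 (D.cols_bounds c hc)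
  ones := D.ones
  ones_isBox r c h := by
    obtain ⟨h1, h2, h3, -⟩ := D.mem_ones.1 h
    exact ⟨(D.mem_rows r).1 h1, h2, abs_le.2 ⟨D.neg_le_of_mem_ones h, h3.le⟩⟩
  exists_one c hc := by
    have hg := D.good (D.cols_bounds c hc).2
    have h1 := hg.le_carry hc le_rfl
    have h2 := D.colEnd_lt c hc
    -- The end carried to the bottom is `c > colEnd c`, so some row replaces the end of the column
    -- path; the topmost row able to do so contains a `1`.
    let S := D.rows.filter fun r => r < c ∧ D.colEnd c < D.value c r
    have hS : S.Nonempty := by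
      rcases D.carry_eq c c with h3 | ⟨r, h3, h4, h5⟩
      · omega
      · exact ⟨r, Finset.mem_filter.2 ⟨h3, h4, by omega⟩⟩
    obtain ⟨r, hr, hmin⟩ := S.exists_min_image id hS
    obtain ⟨h3, h4, h5⟩ := Finset.mem_filter.1 hr
    refine ⟨r, D.mem_ones.2 ⟨h3, hc, h4, lt_of_le_of_lt ?_ h5⟩⟩
    refine (D.carry_le_iff _ _ _).2 ⟨le_rfl, fun r' h6 h7 => ?_⟩
    by_contra h8
    have := hmin r' (Finset.mem_filter.2 ⟨h6, by omega, by omega⟩)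
    simp only [id] at this
    omega
  hinge r c r' c' hb h1 h2 h3 h4 := by
    obtain ⟨h5, h6, h7, h8⟩ := D.mem_ones.1 h2
    obtain ⟨h9, -⟩ := D.mem_ones.1 h4
    have hrec := D.isRecord_of_mem_ones h4 h3
    have hrc : r < c := by
      refine lt_of_le_of_ne (abs_le.1 hb.2.2).2 ?_
      rintro rfl
      exact (D.rows_bounds h9).2.2.1 h6
    refine D.mem_ones.2 ⟨h9, h6, hrc, ?_⟩
    -- The `1` in row `r'` puts its end above `colEnd c`. The record in row `r` exceeds it and all
    -- other ends above, hence the carried maximum.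
    have h10 := D.colEnd_le_carry c r'
    have h11 := hrec r' h5 h1
    have : D.carry c r ≤ D.value c r - 1 := by
      refine (D.carry_le_iff _ _ _).2 ⟨by omega, fun r'' h12 h13 => ?_⟩
      have := hrec r'' h12 h13
      omega
    omega
  diag i hi h c := by
    rcases D.diag i hi with h1 | h1
    · exact absurd (D.diag_mem_ones hi h1) h
    · exact D.notMem_ones_of_rowEnd h1 c

/-- The prescribed end of the path through a position. -/
def endOf (D : PathEnds n) (s : ZState) : ℤ :=
  match s.dir with
  | .east => D.value s.col s.row
  | .south => D.carry s.col s.row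

/-- By the choice of the `1`s, the smaller end always leaves east and the larger one south, as in
the recursion. -/
theorem endOf_step (D : PathEnds n) {s : ZState} (hs : D.tableau.Valid s) (h : s.row < s.col)
    (hn : s.col ≤ n) : D.endOf (D.tableau.step s) = D.endOf s := by
  obtain ⟨d, r, c⟩ := s
  simp only at h hn
  have hones : (r, c) ∈ D.tableau.ones ↔
      r ∈ D.rows ∧ c ∈ D.cols ∧ r < c ∧ D.carry c r < D.value c r := D.mem_ones
  cases d
  · have hr : r ∈ D.rows := (D.mem_rows r).2 hs
    simp only [PermTableauB.step]
    split_ifs with h1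
    · simp only [endOf]
      rw [D.carry_succ_of_mem c hr, max_eq_right (hones.1 h1).2.2.2.le]
    · simp only [endOf]
      rw [D.value_pred hn]
      split_ifs with h2
      · refine min_eq_right (not_lt.1 fun h3 => h1 (hones.2 ⟨hr, h2.1, h, h3⟩))
      · rfl
  · have hc : c ∈ D.cols := hs
    simp only [PermTableauB.step]
    split_ifs with h1
    · simp only [endOf]
      rw [D.value_pred hn, if_pos ⟨hc, h⟩, min_eq_left (hones.1 h1).2.2.2.le]
    · simp only [endOf]
      by_cases hr : r ∈ D.rows
      · rw [D.carry_succ_of_mem c hr]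
        exact max_eq_left (not_lt.1 fun h3 => h1 (hones.2 ⟨hr, hc, h, h3⟩))
      · exact D.carry_succ_of_notMem c hr

theorem endLabel_tableau (D : PathEnds n) {s : ZState} (hs : D.tableau.Valid s)
    (h : s.row ≤ s.col) (hn : s.col ≤ n) : D.tableau.endLabel s = D.endOf s := by
  -- Only one path matters here; the second argument of the induction is a dummy.
  refine D.tableau.path_induction (P := fun x _ => D.tableau.endLabel x = D.endOf x)
    (Q := fun x _ => D.tableau.Valid x ∧ x.col ≤ n) ?_ ?_ ?_ s s h ⟨hs, hn⟩
  · exact fun x _ _ h1 => ⟨D.tableau.valid_step h1.1,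
      (D.tableau.iterate_col_le x 1).trans h1.2⟩
  · rintro ⟨d, r, c⟩ _ h1 ⟨h2, h3⟩
    rw [D.tableau.endLabel_of_diff_eq_zero h1]
    simp only at h1 h3
    subst h1
    have hg := D.good h3
    cases d
    · have hr : c ∈ D.rows := (D.mem_rows c).2 h2
      exact le_antisymm (hg.le_value c hr) (hg.value_le c hr le_rfl)
    · exact le_antisymm (hg.le_carry h2 le_rfl) (hg.carry_le h2 le_rfl)
  · rintro x _ h1 ⟨h2, h3⟩ h4
    rw [← D.tableau.endLabel_step h1, h4, D.endOf_step h2 h1 h3]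

theorem endLabel_rowStart (D : PathEnds n) {r : ℤ} (hr : r ∈ D.rows) :
    D.tableau.endLabel (PermTableauB.rowStart n r) = D.rowEnd r := by
  have h := D.rows_bounds hr
  have hv : D.tableau.Valid (PermTableauB.rowStart n r) := (D.mem_rows r).1 hr
  rw [D.endLabel_tableau hv h.2.1 le_rfl]
  exact D.value_top r

theorem endLabel_colStart (D : PathEnds n) {c : ℤ} (hc : c ∈ D.cols) :
    D.tableau.endLabel (PermTableauB.colStart n c) = D.colEnd c := by
  have h := D.cols_bounds c hc
  have hv : D.tableau.Valid (PermTableauB.colStart n c) := hc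
  rw [D.endLabel_tableau hv (by simp only [PermTableauB.colStart]; omega) h.2]
  -- No row lies above row `-n`, so nothing has yet replaced the end of the column path.
  refine le_antisymm ((D.carry_le_iff _ _ _).2 ⟨le_rfl, fun r hr h1 => ?_⟩) (D.colEnd_le_carry _ _)
  have := D.rows_bounds hr
  simp only [PermTableauB.colStart] at h1
  omega

theorem zetaPos_tableau (D : PathEnds n) {i : ℤ} (h1 : 1 ≤ i) (h2 : i ≤ n) :
    D.tableau.zetaPos i =
      if i ∉ D.cols then D.rowEnd i
      else if D.colEnd i = -i then -D.rowEnd (-i) else D.colEnd i := by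
  unfold PermTableauB.zetaPos
  by_cases hi : i ∈ D.cols
  · rw [if_neg (not_not.2 hi), if_neg (not_not.2 (show i ∈ D.tableau.cols from hi)),
      D.endLabel_colStart hi, D.endLabel_rowStart (D.neg_mem_rows hi)]
    by_cases h3 : D.colEnd i = -i
    · rw [if_pos h3, if_neg]
      exact not_not.2 (D.diag_mem_ones hi h3)
    · rw [if_neg h3, if_pos]
      exact D.notMem_ones_of_rowEnd ((D.diag i hi).resolve_left h3) i
  · rw [if_pos hi, if_pos (show i ∉ D.tableau.cols from hi), D.endLabel_rowStart]
    exact (D.mem_rows i).2 (Or.inl ⟨h1, h2, hi⟩)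

end PathEnds

namespace SignedPerm

variable {n : ℕ}

/-- The labels `i ∈ [n]` of the columns of the tableau of `σ`. -/
noncomputable def cols (σ : SignedPerm n) : Finset ℤ :=
  (Finset.Icc 1 (n : ℤ)).filter fun i => toInt σ i < i

theorem mem_cols {σ : SignedPerm n} {i : ℤ} :
    i ∈ cols σ ↔ 1 ≤ i ∧ i ≤ n ∧ toInt σ i < i := by
  simp only [cols, Finset.mem_filter, Finset.mem_Icc, and_assoc]

theorem isRowLabel_cols_iff {σ : SignedPerm n} {r : ℤ} :
    IsRowLabel n (cols σ) r ↔ (1 ≤ r ∧ r ≤ n ∧ r ≤ toInt σ r) ∨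
      (r ≤ -1 ∧ -(n : ℤ) ≤ r ∧ r < toInt σ r) := by
  have := toInt_neg σ r
  rw [IsRowLabel, mem_cols, mem_cols]
  omega

open Classical in
/-- The ends of the paths in a tableau for `σ`. -/
noncomputable def pathEnds (σ : SignedPerm n) : PathEnds n :=
  have hrow : ∀ r, r ∈ (Finset.Icc (-(n : ℤ)) n).filter (IsRowLabel n (cols σ)) ↔
      IsRowLabel n (cols σ) r := by
    intro r
    rw [Finset.mem_filter, Finset.mem_Icc, isRowLabel_cols_iff]
    omega
  have hmem : ∀ r : ℤ, 1 ≤ r → r ≤ n → IsRowLabel n (cols σ) r ∨ r ∈ cols σ := by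
    intro r h1 h2
    rw [isRowLabel_cols_iff, mem_cols]
    omega
  have hneg : ∀ c ∈ cols σ, IsRowLabel n (cols σ) (-c) := fun c hc =>
    Or.inr (by rwa [neg_neg])
  { cols := cols σ
    cols_bounds := fun c hc => ⟨(mem_cols.1 hc).1, (mem_cols.1 hc).2.1⟩
    rows := (Finset.Icc (-(n : ℤ)) n).filter (IsRowLabel n (cols σ))
    mem_rows := hrow
    -- A row with a negative value is some `-i` with `σ(i) > 0`: its diagonal will be `0` and its
    -- path trivial.
    rowEnd := fun r => if 0 < toInt σ r then toInt σ r else r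
    -- A column with a negative value will have a `1` in its diagonal, where its path turns and
    -- leaves at `-c`.
    colEnd := fun c => if 0 < toInt σ c then toInt σ c else -c
    rowEnd_mem := by
      intro r hr
      rw [Finset.mem_union, hrow]
      split_ifs with h
      · rw [hrow, isRowLabel_cols_iff] at hr
        have := toInt_bounds σ (z := r) (by omega)
        exact hmem _ (by omega) (by omega)
      · exact Or.inl ((hrow r).1 hr)
    colEnd_mem := by
      intro c hc
      rw [Finset.mem_union, hrow]
      have h1 := mem_cols.1 hc
      have := toInt_bounds σ (z := c) (by omega)
      split_ifs with h
      · exact hmem _ (by omega) (by omega)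
      · exact Or.inl (hneg c hc)
    le_rowEnd := by
      intro r hr
      rw [hrow, isRowLabel_cols_iff] at hr
      split_ifs <;> omega
    colEnd_lt := by
      intro c hc
      rw [mem_cols] at hc
      split_ifs <;> omega
    neg_le_colEnd := by
      intro c hc
      rw [mem_cols] at hc
      split_ifs <;> omega
    rowEnd_inj := by
      intro r hr r' hr' h
      rw [hrow, isRowLabel_cols_iff] at hr hr'
      split_ifs at h
      · exact toInt_injective σ (by omega) (by omega) h
      · omega
      · omega
      · exact h
    colEnd_inj := by
      intro r hr r' hr' h
      rw [mem_cols] at hr hr'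
      split_ifs at h
      · exact toInt_injective σ (by omega) (by omega) h
      · omega
      · omega
      · omega
    rowEnd_ne_colEnd := by
      intro r hr c hc h
      rw [hrow, isRowLabel_cols_iff] at hr
      rw [mem_cols] at hc
      have h1 := toInt_bounds σ (z := c) (by omega)
      split_ifs at h
      · have := toInt_injective σ (by omega) (by omega) h
        subst this
        omega
      · omega
      · omega
      · subst h
        rw [toInt_neg] at *
        omega
    diag := by
      intro c hc
      have := toInt_neg σ c
      by_cases h : 0 < toInt σ c
      · exact Or.inr (if_neg (by omega))
      · exact Or.inl (if_neg h) }

theorem zeta_pathEnds (σ : SignedPerm n) : (pathEnds σ).tableau.zeta = σ := by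
  refine ext_toInt fun i h1 h2 => ?_
  rw [PermTableauB.toInt_zeta _ h1 h2, PathEnds.zetaPos_tableau _ h1 h2]
  have h3 := toInt_neg σ i
  have h4 := toInt_bounds σ (z := i) (by omega)
  simp only [pathEnds, mem_cols]
  split_ifs <;> omega

end SignedPerm

/-! ### Length and inversions -/

namespace SignedPerm

variable {n : ℕ}

theorem toInt_one {z : ℤ} (h : z ≠ 0 ∧ -(n : ℤ) ≤ z ∧ z ≤ n) : toInt (1 : SignedPerm n) z = z := by
  rw [toInt, dif_pos h]
  rfl

theorem simpleFun_involutive (i : ℕ) : Function.Involutive (simpleFun i) := by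
  intro x
  unfold simpleFun
  split_ifs <;> omega

theorem toInt_mul_simple (σ : SignedPerm n) (i : Fin n) {z : ℤ}
    (h : z ≠ 0 ∧ -(n : ℤ) ≤ z ∧ z ≤ n) :
    toInt (σ * simple i) z = toInt σ (simpleFun i.1 z) := by
  rw [toInt, dif_pos h]
  exact (toInt_coe σ (simpleMap i ⟨z, h⟩)).symm

theorem simple_mul_self (i : Fin n) : simple i * simple i = 1 :=
  Subtype.ext (Equiv.ext (simpleMap_involutive i))

/-- The positive roots that `σ` sends to negative ones, a root being recorded as a pair `(x, y)`
with `-y ≤ x < y`. -/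
noncomputable def invRoots (σ : SignedPerm n) : Finset (ℤ × ℤ) :=
  (Finset.Icc (-(n : ℤ)) n ×ˢ Finset.Icc 1 (n : ℤ)).filter fun p =>
    p.1 ≠ 0 ∧ -p.2 ≤ p.1 ∧ p.1 < p.2 ∧ toInt σ p.2 < toInt σ p.1

theorem mem_invRoots {σ : SignedPerm n} {x y : ℤ} :
    (x, y) ∈ invRoots σ ↔
      x ≠ 0 ∧ 1 ≤ y ∧ y ≤ n ∧ -y ≤ x ∧ x < y ∧ toInt σ y < toInt σ x := by
  simp only [invRoots, Finset.mem_filter, Finset.mem_product, Finset.mem_Icc]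
  omega

theorem card_invRoots (σ : SignedPerm n) : (invRoots σ).card = inv σ := by
  rw [inv, ← Finset.card_filter_add_card_filter_not (s := invRoots σ) (fun p => 0 < p.1)]
  congr 1
  · refine (Finset.card_bij (fun p _ => (p.1.1, p.2.1)) ?_ ?_ ?_).symm
    · rintro ⟨x, y⟩ h
      simp only [Finset.mem_filter, Finset.mem_univ, true_and, ← Subtype.coe_lt_coe,
        ← toInt_coe] at h
      have h2 := y.2
      exact Finset.mem_filter.2 ⟨mem_invRoots.2 (by dsimp only; omega), h.1⟩
    · intro p _ q _ h
      simp only [Prod.mk.injEq] at h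
      exact Prod.ext (Subtype.ext h.1) (Subtype.ext h.2)
    · rintro ⟨x, y⟩ h
      obtain ⟨h1, h2⟩ := Finset.mem_filter.1 h
      rw [mem_invRoots] at h1
      refine ⟨(⟨x, by omega⟩, ⟨y, by omega⟩), ?_, rfl⟩
      simp only [Finset.mem_filter, Finset.mem_univ, true_and, ← Subtype.coe_lt_coe,
        ← toInt_coe]
      exact ⟨h2, h1.2.2.2.2⟩
  · refine (Finset.card_bij (fun p _ => (-p.1.1, p.2.1)) ?_ ?_ ?_).symm
    · rintro ⟨x, y⟩ h
      simp only [Finset.mem_filter, Finset.mem_univ, true_and, ← Subtype.coe_lt_coe,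
        ← Subtype.coe_le_coe, ← toInt_coe, PM.val_neg] at h
      have h2 := y.2
      exact Finset.mem_filter.2 ⟨mem_invRoots.2 (by dsimp only; omega), by simp only; omega⟩
    · intro p _ q _ h
      simp only [Prod.mk.injEq, neg_inj] at h
      exact Prod.ext (Subtype.ext h.1) (Subtype.ext h.2)
    · rintro ⟨x, y⟩ h
      obtain ⟨h1, h2⟩ := Finset.mem_filter.1 h
      rw [mem_invRoots] at h1
      simp only at h2
      refine ⟨(⟨-x, by omega⟩, ⟨y, by omega⟩), ?_, by simp⟩
      simp only [Finset.mem_filter, Finset.mem_univ, true_and, ← Subtype.coe_lt_coe,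
        ← Subtype.coe_le_coe, ← toInt_coe, PM.val_neg, neg_neg]
      omega

/-- The action of `sᵢ` on the positive roots other than the `i`th simple root. -/
def reflectRoot (i : ℕ) (p : ℤ × ℤ) : ℤ × ℤ :=
  if i ≠ 0 ∧ p.1 = -i ∧ p.2 = i + 1 then p else (simpleFun i p.1, simpleFun i p.2)

/-- The `i`th simple root. -/
def simpleRoot (i : ℕ) : ℤ × ℤ := if i = 0 then (-1, 1) else ((i : ℤ), (i : ℤ) + 1)

/-- The pair `(-i, i + 1)` is exceptional because `sᵢ` sends it to `(-(i + 1), i)`, another name for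
the same root that violates `-y ≤ x`. The hypothesis `hp` excludes that second name. -/
theorem reflectRoot_reflectRoot (i : ℕ) (p : ℤ × ℤ) (hp : -p.2 ≤ p.1) :
    reflectRoot i (reflectRoot i p) = p := by
  obtain ⟨x, y⟩ := p
  simp only at hp
  by_cases h : i ≠ 0 ∧ x = -i ∧ y = i + 1
  · simp only [reflectRoot, h, ne_eq, not_false_eq_true, and_self, if_true]
  · have h1 : ¬ (i ≠ 0 ∧ simpleFun i x = -i ∧ simpleFun i y = i + 1) := by
      rintro ⟨h2, h3, h4⟩
      have h5 := simpleFun_involutive i x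
      have h6 := simpleFun_involutive i y
      rw [h3] at h5
      rw [h4] at h6
      rw [← h5, ← h6] at hp
      unfold simpleFun at hp
      split_ifs at hp <;> omega
    simp only [reflectRoot, if_neg h, if_neg h1, simpleFun_involutive i x,
      simpleFun_involutive i y]

theorem reflectRoot_spec {i : ℕ} (hi : i < n) {x y : ℤ} (h : (x, y) ≠ simpleRoot i) (hx : x ≠ 0)
    (hy : 1 ≤ y) (hyn : y ≤ n) (hxy : -y ≤ x) (hlt : x < y) :
    (reflectRoot i (x, y)).1 ≠ 0 ∧ 1 ≤ (reflectRoot i (x, y)).2 ∧ (reflectRoot i (x, y)).2 ≤ n ∧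
      -(reflectRoot i (x, y)).2 ≤ (reflectRoot i (x, y)).1 ∧
      (reflectRoot i (x, y)).1 < (reflectRoot i (x, y)).2 ∧
      reflectRoot i (x, y) ≠ simpleRoot i := by
  simp only [reflectRoot, simpleRoot, simpleFun] at h ⊢
  by_cases h0 : i = 0
  · subst h0
    simp only [Nat.cast_zero, if_true, ne_eq, not_true_eq_false, false_and, if_false,
      Prod.mk.injEq] at h ⊢
    split_ifs <;> omega
  · have h0' : (i : ℤ) ≠ 0 := by omega
    simp only [h0, h0', if_false, ne_eq, not_false_eq_true, true_and, Prod.mk.injEq] at h ⊢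
    by_cases h1 : x = -i ∧ y = i + 1
    · simp only [h1, and_self, if_true, Prod.mk.injEq]
      omega
    · simp only [h1, if_false, Prod.mk.injEq]
      split_ifs <;> omega

/-- For the exceptional pair the two inequalities are equivalent because `σ` is odd. -/
theorem toInt_reflectRoot (σ : SignedPerm n) (i : ℕ) (x y : ℤ) :
    toInt σ (reflectRoot i (x, y)).2 < toInt σ (reflectRoot i (x, y)).1 ↔
      toInt σ (simpleFun i y) < toInt σ (simpleFun i x) := by
  unfold reflectRoot
  split_ifs with h
  · obtain ⟨h1, rfl, rfl⟩ := h
    have h2 : simpleFun i (-i) = -(i + 1) := by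
      unfold simpleFun
      split_ifs <;> omega
    have h3 : simpleFun i (i + 1) = i := by
      unfold simpleFun
      split_ifs <;> omega
    simp only [h2, h3, toInt_neg]
    omega
  · rfl

/-- The reflection permutes the positive roots other than the simple one, which itself changes sign;
so exactly one inverted root is lost. -/
theorem inv_mul_simple_of_mem {σ : SignedPerm n} {i : Fin n} (h : simpleRoot i ∈ invRoots σ) :
    inv (σ * simple i) + 1 = inv σ := by
  have hnot : simpleRoot i ∉ invRoots (σ * simple i) := by
    have h2 := i.2
    intro h1
    unfold simpleRoot at h h1
    split_ifs at h h1 with h0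
    · rw [mem_invRoots] at h h1
      rw [toInt_mul_simple σ i (by omega), toInt_mul_simple σ i (by omega), h0] at h1
      simp only [simpleFun, Nat.cast_zero, if_true, true_or, or_true, neg_neg] at h1
      omega
    · rw [mem_invRoots] at h h1
      rw [toInt_mul_simple σ i (by omega), toInt_mul_simple σ i (by omega)] at h1
      have h3 : simpleFun (i : ℕ) (i : ℕ) = (i : ℕ) + 1 := by
        unfold simpleFun
        split_ifs <;> omega
      have h4 : simpleFun (i : ℕ) ((i : ℕ) + 1) = (i : ℕ) := by
        unfold simpleFun
        split_ifs <;> omega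
      rw [h3, h4] at h1
      omega
  rw [← card_invRoots, ← card_invRoots, ← Finset.card_erase_add_one h]
  congr 1
  refine Finset.card_bij' (fun p _ => reflectRoot i p) (fun p _ => reflectRoot i p) ?_ ?_ ?_ ?_
  · rintro ⟨x, y⟩ hp
    have hne : (x, y) ≠ simpleRoot i := fun h => hnot (h ▸ hp)
    obtain ⟨h1, h2, h3, h4, h5, h6⟩ := mem_invRoots.1 hp
    obtain ⟨g1, g2, g3, g4, g5, g6⟩ := reflectRoot_spec i.2 hne h1 h2 h3 h4 h5
    refine Finset.mem_erase.2 ⟨g6, mem_invRoots.2 ⟨g1, g2, g3, g4, g5, ?_⟩⟩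
    rw [toInt_mul_simple σ i (by omega), toInt_mul_simple σ i (by omega)] at h6
    exact (toInt_reflectRoot σ i x y).2 h6
  · rintro ⟨x, y⟩ hp
    obtain ⟨hne, hp⟩ := Finset.mem_erase.1 hp
    obtain ⟨h1, h2, h3, h4, h5, h6⟩ := mem_invRoots.1 hp
    obtain ⟨g1, g2, g3, g4, g5, g6⟩ := reflectRoot_spec i.2 hne h1 h2 h3 h4 h5
    refine mem_invRoots.2 ⟨g1, g2, g3, g4, g5, ?_⟩
    have hb : ∀ z : ℤ, z ≠ 0 ∧ -(n : ℤ) ≤ z ∧ z ≤ n →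
        simpleFun (i : ℕ) z ≠ 0 ∧ -(n : ℤ) ≤ simpleFun (i : ℕ) z ∧ simpleFun (i : ℕ) z ≤ n :=
      fun z hz => (simpleMap i ⟨z, hz⟩).2
    refine (toInt_reflectRoot (σ * simple i) i x y).2 ?_
    rw [toInt_mul_simple σ i (hb x (by omega)),
      toInt_mul_simple σ i (hb y (by omega)), simpleFun_involutive i x, simpleFun_involutive i y]
    exact h6
  · exact fun p hp => reflectRoot_reflectRoot i p (mem_invRoots.1 hp).2.2.2.1
  · exact fun p hp => reflectRoot_reflectRoot i p
      (mem_invRoots.1 (Finset.mem_of_mem_erase hp)).2.2.2.1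

theorem simpleRoot_mem_invRoots {σ : SignedPerm n} {i : Fin n} :
    simpleRoot i ∈ invRoots σ ↔
      if (i : ℕ) = 0 then toInt σ 1 < 0 else toInt σ ((i : ℕ) + 1) < toInt σ (i : ℕ) := by
  have h1 := i.2
  unfold simpleRoot
  split_ifs with h
  · rw [mem_invRoots, toInt_neg]
    omega
  · rw [mem_invRoots]
    omega

/-- If `σ` does not invert the simple root, then `σ * simple i` does, and the previous lemma applies
to it. -/
theorem inv_mul_simple_le (σ : SignedPerm n) (i : Fin n) : inv (σ * simple i) ≤ inv σ + 1 := by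
  by_cases h : simpleRoot i ∈ invRoots σ
  · have := inv_mul_simple_of_mem h
    omega
  · have h1 : simpleRoot i ∈ invRoots (σ * simple i) := by
      have h2 := i.2
      rw [simpleRoot_mem_invRoots] at h ⊢
      split_ifs at h ⊢ with h0
      · have h3 := toInt_bounds σ (z := 1) (by omega)
        rw [toInt_mul_simple σ i (by omega), h0]
        simp only [simpleFun, Nat.cast_zero, if_true, true_or, toInt_neg]
        omega
      · have h3 : simpleFun (i : ℕ) (i : ℕ) = (i : ℕ) + 1 := by
          unfold simpleFun
          split_ifs <;> omega
        have h4 : simpleFun (i : ℕ) ((i : ℕ) + 1) = (i : ℕ) := by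
          unfold simpleFun
          split_ifs <;> omega
        rw [toInt_mul_simple σ i (by omega), toInt_mul_simple σ i (by omega), h3, h4]
        refine lt_of_le_of_ne (not_lt.1 h) fun h5 => ?_
        have := toInt_injective σ (by omega) (by omega) h5
        omega
    have := inv_mul_simple_of_mem h1
    rw [mul_assoc, simple_mul_self, mul_one] at this
    omega

theorem inv_one : inv (1 : SignedPerm n) = 0 := by
  rw [← card_invRoots, Finset.card_eq_zero, Finset.eq_empty_iff_forall_notMem]
  rintro ⟨x, y⟩ h
  rw [mem_invRoots] at h
  rw [toInt_one (by omega), toInt_one (by omega)] at h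
  omega

theorem inv_prod_le (w : List (Fin n)) : inv (w.map simple).prod ≤ w.length := by
  induction w using List.reverseRecOn with
  | nil => simp [inv_one]
  | append_singleton w i ih =>
    simp only [List.map_append, List.map_cons, List.map_nil, List.prod_append, List.prod_cons,
      List.prod_nil, mul_one, List.length_append, List.length_cons, List.length_nil]
    have := inv_mul_simple_le (w.map simple).prod i
    omega

/-- Such a `σ` is increasing on `[n]` with `σ(1) > 0`. Counting up from `1` gives `σ(z) ≥ z`,
counting down from `n` gives `σ(z) ≤ z`. -/
theorem eq_one_of_forall_notMem {σ : SignedPerm n} (h : ∀ i : Fin n, simpleRoot i ∉ invRoots σ) :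
    σ = 1 := by
  have hstep : ∀ i : ℤ, 1 ≤ i → i < n → toInt σ i < toInt σ (i + 1) := by
    intro i h1 h2
    have h3 := h ⟨i.toNat, by omega⟩
    rw [simpleRoot_mem_invRoots, if_neg (by simp only; omega)] at h3
    simp only [Int.toNat_of_nonneg (show 0 ≤ i by omega)] at h3
    refine lt_of_le_of_ne (not_lt.1 h3) fun h5 => ?_
    have := toInt_injective σ (by omega) (by omega) h5
    omega
  have hlow : ∀ k : ℕ, (k : ℤ) + 1 ≤ n → (k : ℤ) + 1 ≤ toInt σ (k + 1) := by
    intro k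
    induction k with
    | zero =>
      intro h1
      have h2 := h ⟨0, by omega⟩
      rw [simpleRoot_mem_invRoots, if_pos rfl] at h2
      have h3 := toInt_bounds σ (z := 1) (by omega)
      simp only [Nat.cast_zero, zero_add]
      omega
    | succ k ih =>
      intro h1
      push_cast at h1 ⊢
      have := hstep (k + 1) (by omega) (by omega)
      have := ih (by omega)
      omega
  have hup : ∀ k : ℕ, (k : ℤ) < n → toInt σ (n - k) ≤ n - k := by
    intro k
    induction k with
    | zero =>
      intro h1
      have h3 := toInt_bounds σ (z := n) (by omega)
      simp only [Nat.cast_zero, sub_zero]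
      omega
    | succ k ih =>
      intro h1
      push_cast at h1 ⊢
      have h2 := hstep (n - (k + 1)) (by omega) (by omega)
      rw [show (n - (k + 1) + 1 : ℤ) = n - k by ring] at h2
      have := ih (by omega)
      omega
  refine ext_toInt fun z h1 h2 => ?_
  rw [toInt_one (by omega)]
  have h3 := hlow (z - 1).toNat (by omega)
  have h4 := hup (n - z).toNat (by omega)
  rw [show (((z - 1).toNat : ℕ) : ℤ) + 1 = z by omega] at h3
  rw [show (n - ((n - z).toNat : ℕ) : ℤ) = z by omega] at h4
  omega

/-- As long as `σ` is not the identity, it inverts some simple root, and multiplying by that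
generator lowers `inv` by one. -/
theorem exists_word (σ : SignedPerm n) :
    ∃ w : List (Fin n), w.length = inv σ ∧ (w.map simple).prod = σ := by
  obtain ⟨m, hm⟩ : ∃ m, inv σ = m := ⟨_, rfl⟩
  induction m generalizing σ with
  | zero =>
    refine ⟨[], by simp [hm], ?_⟩
    refine (eq_one_of_forall_notMem fun i hi => ?_).symm
    have := inv_mul_simple_of_mem hi
    omega
  | succ m ih =>
    by_cases h : ∃ i : Fin n, simpleRoot i ∈ invRoots σ
    · obtain ⟨i, hi⟩ := h
      have h1 := inv_mul_simple_of_mem hi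
      obtain ⟨w, h2, h3⟩ := ih (σ * simple i) (by omega)
      refine ⟨w ++ [i], by simp [h2, h1], ?_⟩
      simp [h3, mul_assoc, simple_mul_self]
    · push Not at h
      rw [eq_one_of_forall_notMem h, inv_one] at hm
      omega

theorem length_eq_inv (σ : SignedPerm n) : length σ = inv σ := by
  refine le_antisymm (Nat.sInf_le (exists_word σ)) (le_csInf ⟨_, exists_word σ⟩ ?_)
  rintro k ⟨w, rfl, rfl⟩
  exact inv_prod_le w

end SignedPerm

/-! ### The main theorem. -/

theorem theorem4p3 (n : ℕ) (σ : SignedPerm n) :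
    (∃! T : PermTableauB n, T.zeta = σ) ∧
    ∀ T : PermTableauB n, T.zeta = σ →
      SignedPerm.length σ = SignedPerm.inv σ ∧
        SignedPerm.inv σ = 2 * (T.zeroEE + T.zeroNN) + T.one := by
  refine ⟨⟨(SignedPerm.pathEnds σ).tableau, SignedPerm.zeta_pathEnds σ, fun T hT => ?_⟩, ?_⟩
  · exact PermTableauB.zeta_injective (hT.trans (SignedPerm.zeta_pathEnds σ).symm)
  · rintro T rfl
    exact ⟨SignedPerm.length_eq_inv _, T.inv_zeta⟩
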